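/- Let $k\ge 1$ and let $z_1,\dots,z_n$ be a sequence of requested elements. A cache holds at most $k$ elements and is initially empty. A request to an element that is not in the cache is a \emph{miss}: the element is brought into the cache, and if the cache was full, an element is evicted. Together with the request $z_t$ an oracle supplies a real number $h_t$, a prediction of the time of the next request to the element $z_t$. All predictions are compared through a fixed linear order $\prec$ on $\{1,\dots,n\}$ with $s\prec t$ whenever $h_s<h_t$ (ties are broken in an arbitrary but fixed way). Let $H_k=\sum_{i=1}^k 1/i$. \emph{Predictive Marker} works in phases, keeping a set $M$ of marked elements and a set $S$ of possibly stale elements, both initially empty. When $z_t$ arrives and is in the cache $C$, it is marked. If $z_t\notin C$ and $|C|<k$, it is inserted and marked. Otherwise: if $|M|=k$, a new phase starts, with $S:=C$ and $M:=\emptyset$. Then an element $e\in C\setminus M$ is evicted, and $z_t$ is inserted and marked. The choice of $e$ is as follows. If $z_t\notin S$ ($z_t$ is clean), a new chain of length $1$ is started. If $z_t\in S$, then $z_t$ was evicted during the current phase and is the representative of one chain of this phase, whose length is increased by $1$. If $z_t$ is clean or the length of the chain is now at most $H_k$, then $e$ is the element of $C\setminus M$ whose most recent prediction is the latest with respect to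 $\prec$; otherwise $e$ is uniformly random in $C\setminus M$, independently of the past. In either case $e$ becomes the representative of the chain. The error $\eta_{ed}$ of the oracle is defined as follows. Let $(e,i)$ denote the $i$-th arrival of the element $e$; for $i\ge 2$ its predicted arrival time is the prediction made at the arrival $(e,i-1)$. Let $A$ be the sequence of all arrivals $(e,i)$ with $i\ge 2$ in increasing order of their true arrival times, and $B$ the sequence of the same pairs in increasing order, with respect to $\prec$, of their predicted arrival times. Then $\eta_{ed}$ is the edit distance (least number of insertions, deletions and substitutions) between $A$ and $B$. Let $\mathrm{ALG}$ be the expected number of misses of Predictive Marker and $\mathrm{OPT}$ the least number of misses of an offline schedule for $z_1,\dots,z_n$ that starts with an empty cache of size $k$. Then $$\mathrm{ALG}\le\min\Bigl(3+\frac{2\eta_{ed}}{\mathrm{OPT}},\,4H_k\Bigr)\cdot\mathrm{OPT},$$ that is, the competitive ratio is at most $\min(3+2\eta_{ed}/\mathrm{OPT},4H_k)$. The same holds if insertions into a cache that is not full are free, that is, if evictions are counted instead of misses, both for $\mathrm{ALG}$ and for $\mathrm{OPT}$. (If $\mathrm{OPT}=0$, then $\mathrm{ALG}=0$.) -/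

import Mathlib

open scoped ENNReal

noncomputable section

namespace Caching

/-- Predicted times are real numbers; ties between equal predictions are broken by a second,
integral coordinate. Comparison is lexicographic. -/
abbrev Key : Type := ℝ ×ₗ ℕ

/-- The prediction made at time `t`, together with its tie-breaking value. -/
def key {n : ℕ} (h : Fin n → ℝ) (tie : Fin n → ℕ) (t : Fin n) : Key := toLex (h t, tie t)

/-! ### Predictive Marker -/

/-- The state of Predictive Marker between two requests. -/
structure State (α : Type*) where
  /-- the cache `C` -/
  cache : Finset α
  /-- the set `M` of marked elements -/
  marked : Finset α
  /-- the set `S` of possibly stale elements: the contents of the cache when the current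
  phase began (empty in the first phase) -/
  stale : Finset α
  /-- the last prediction `p(e)` received for the element `e` -/
  pred : α → Key
  /-- `chainLen e` is the length of the clean chain of the current phase whose representative
  is `e`; every chain has exactly one representative, so that chains are named by it -/
  chainLen : α → ℕ
  /-- number of requests so far to elements that were not in the cache -/
  misses : ℕ
  /-- number of elements evicted so far -/
  evictions : ℕ

/-- The initial state: empty cache, nothing marked. -/
def State.init (α : Type*) : State α where
  cache := ∅
  marked := ∅
  stale := ∅
  pred := fun _ => toLex (0, 0)
  chainLen := fun _ => 0
  misses := 0
  evictions := 0

/-- The element of the nonempty set `U` with the highest predicted time. -/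
def argmaxPred {α : Type*} (p : α → Key) (U : Finset α) (hU : U.Nonempty) : α :=
  (U.exists_max_image p hU).choose

/-- If `k` elements are marked, a miss starts a new phase: the current cache becomes the set of
possibly stale elements and all marks are removed. -/
def State.newPhase {α : Type*} (k : ℕ) (s : State α) : State α :=
  if s.marked.card = k then { s with stale := s.cache, marked := ∅ } else s

open Classical in
/-- Length of the clean chain to which a missing element `z` belongs, once the miss is accounted
for: a clean element starts a new chain; a missing stale element is the representative of a chain,
which is extended by one. -/
def State.newLen {α : Type*} (s : State α) (z : α) : ℕ :=
  if z ∈ s.stale then s.chainLen z + 1 else 1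

open Classical in
/-- The distribution of the element evicted for the missing element `z`: if `z` is clean, or `z` is
stale and the length of its chain is at most `H_k`, the unmarked element with the highest predicted
time; otherwise a uniformly random unmarked element. (There always is an unmarked element in the
cache when this is used, so the last branch is not reached.) -/
def State.evictee {α : Type*} (k : ℕ) (s : State α) (z : α) : PMF α :=
  if hU : (s.cache \ s.marked).Nonempty then
    if z ∉ s.stale ∨ (s.newLen z : ℚ) ≤ harmonic k then
      PMF.pure (argmaxPred s.pred (s.cache \ s.marked) hU)
    else
      PMF.uniformOfFinset (s.cache \ s.marked) hU
  else PMF.pure z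

open Classical in
/-- Replace `e` by `z` in the cache, mark `z`, and make `e` the representative of the chain
of `z`. -/
def State.replace {α : Type*} (s : State α) (z e : α) : State α :=
  { s with
    cache := (insert z s.cache).erase e
    marked := insert z s.marked
    chainLen := Function.update s.chainLen e (s.newLen z)
    misses := s.misses + 1
    evictions := s.evictions + 1 }

open Classical in
/-- One round of Predictive Marker with cache size `k`: the element `z` arrives with
prediction `q`. -/
def step {α : Type*} (k : ℕ) (z : α) (q : Key) (s₀ : State α) : PMF (State α) :=
  let s : State α := { s₀ with pred := Function.update s₀.pred z q }
  if z ∈ s.cache then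
    PMF.pure { s with marked := insert z s.marked }
  else if s.cache.card < k then
    PMF.pure { s with
      cache := insert z s.cache
      marked := insert z s.marked
      misses := s.misses + 1 }
  else
    ((s.newPhase k).evictee k z).map ((s.newPhase k).replace z)

/-- The distribution of the state of Predictive Marker after serving the whole request
sequence `z`, where the prediction `h t` comes with the `t`-th request. -/
def predictiveMarker {α : Type*} (k : ℕ) {n : ℕ} (z : Fin n → α) (h : Fin n → ℝ)
    (tie : Fin n → ℕ) : PMF (State α) :=
  (List.finRange n).foldl (fun μ t => μ.bind (step k (z t) (key h tie t)))
    (PMF.pure (State.init α))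

/-- Expected value of a natural-number valued quantity. -/
def expect {S : Type*} (μ : PMF S) (f : S → ℕ) : ℝ≥0∞ := ∑' s, μ s * (f s : ℝ≥0∞)

/-! ### The offline optimum -/

/-- An offline schedule for the requests `z` with a cache of size `k`, initially empty; `C t` is the
cache just before the request at time `t` and `C (t + 1)` the one just after it. Only the requested
element may be fetched, and it must be in the cache once it has been served. -/
structure IsSchedule {α : Type*} (k : ℕ) {n : ℕ} (z : Fin n → α) (C : ℕ → Finset α) : Prop where
  zero : C 0 = ∅
  card_le : ∀ t, (C t).card ≤ k
  mem : ∀ t : Fin n, z t ∈ C (t + 1)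
  subset : ∀ t : Fin n, ∀ x ∈ C (t + 1), x = z t ∨ x ∈ C t

open Classical in
/-- Number of cache misses of a schedule. -/
def scheduleMisses {α : Type*} {n : ℕ} (z : Fin n → α) (C : ℕ → Finset α) : ℕ :=
  (Finset.univ.filter fun t : Fin n => z t ∉ C t).card

open Classical in
/-- Number of elements evicted by a schedule. -/
def scheduleEvictions {α : Type*} (n : ℕ) (C : ℕ → Finset α) : ℕ :=
  ∑ t : Fin n, (C t \ C (t + 1)).card

/-- Smallest number of cache misses of an offline schedule. -/
def optMisses {α : Type*} (k : ℕ) {n : ℕ} (z : Fin n → α) : ℕ :=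
  sInf {m | ∃ C : ℕ → Finset α, IsSchedule k z C ∧ m = scheduleMisses z C}

/-- Smallest number of evictions of an offline schedule. -/
def optEvictions {α : Type*} (k : ℕ) {n : ℕ} (z : Fin n → α) : ℕ :=
  sInf {m | ∃ C : ℕ → Finset α, IsSchedule k z C ∧ m = scheduleEvictions n C}

/-! ### The edit distance error -/

open Classical in
/-- The times before `t` at which the element requested at time `t` was requested. -/
def earlier {α : Type*} {n : ℕ} (z : Fin n → α) (t : Fin n) : Finset (Fin n) :=
  Finset.univ.filter fun s => s < t ∧ z s = z t

/-- The pair `(e, i)` such that the request at time `t` is the `i`-th arrival of `e`. -/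
def arrival {α : Type*} {n : ℕ} (z : Fin n → α) (t : Fin n) : α × ℕ :=
  (z t, (earlier z t).card + 1)

open Classical in
/-- The times, in increasing order, of the arrivals whose time is predicted, that is, of all
arrivals of elements that have arrived before (the `i`-th arrivals with `2 ≤ i`). -/
def predictedTimes {α : Type*} {n : ℕ} (z : Fin n → α) : List (Fin n) :=
  (List.finRange n).filter fun t => (earlier z t).Nonempty

/-- The prediction of the arrival at time `t`: the one made at the preceding arrival of the same
element. (The default value is not used on `predictedTimes`.) -/
def arrivalKey {α : Type*} {n : ℕ} (z : Fin n → α) (h : Fin n → ℝ) (tie : Fin n → ℕ)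
    (t : Fin n) : Key :=
  if ht : (earlier z t).Nonempty then key h tie ((earlier z t).max' ht) else key h tie t

/-- The predicted arrivals `(e, i)` in increasing order of their true arrival time. -/
def trueSeq {α : Type*} {n : ℕ} (z : Fin n → α) : List (α × ℕ) :=
  (predictedTimes z).map (arrival z)

open Classical in
/-- The same pairs `(e, i)` in increasing order of their predicted arrival time. -/
def predictedSeq {α : Type*} {n : ℕ} (z : Fin n → α) (h : Fin n → ℝ) (tie : Fin n → ℕ) :
    List (α × ℕ) :=
  ((predictedTimes z).insertionSort fun s t =>
    arrivalKey z h tie s ≤ arrivalKey z h tie t).map (arrival z)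

open Classical in
/-- The edit (Levenshtein) distance: the least number of insertions, deletions and substitutions of
single entries that turn one list into the other. -/
def editDist {β : Type*} : List β → List β → ℕ
  | [], ys => ys.length
  | _ :: xs, [] => xs.length + 1
  | x :: xs, y :: ys =>
    min (editDist xs (y :: ys) + 1)
      (min (editDist (x :: xs) ys + 1) (editDist xs ys + if x = y then 0 else 1))
termination_by xs ys => xs.length + ys.length

/-- The error of the oracle: the edit distance between the two orderings. -/
def editError {α : Type*} {n : ℕ} (z : Fin n → α) (h : Fin n → ℝ) (tie : Fin n → ℕ) : ℕ :=
  editDist (trueSeq z) (predictedSeq z h tie)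

end Caching

end

noncomputable section

namespace Caching

open Classical
open scoped ENNReal

/-! ### Expectations and runs -/

/-! Phases and clean requests depend only on the request sequence, not on the choices of evictions.
Let L be the number of clean requests after the first phase and D the number of distinct requested
elements. A phase and its predecessor together contain k distinct elements plus one for each clean
request of the phase, so every schedule pays for these clean requests within the two phases. Each
moment lies in at most two such windows, whence L ≤ 2 OPT. For misses the empty initial cache even
gives L + min(k, D) ≤ 2 OPT (`cleanFrom_first_phase_le`).

The expected number of evictions is controlled by a potential: `bound` adds the evictions made so
far, a price `lam` for each clean request to come, a budget `G`, and a potential `φ` for each stale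
element now outside the cache, that is, for each chain representative. Under the local inequalities
`clean`, `det` and `rand` of `IsPotential` no request increases `bound` in expectation, and backward
induction over time gives `expect_run_le`. Two potentials are used.

Ignoring predictions (`isPotential_robust`): a chain has at most ⌊H_k⌋ evictions by prediction. A
random evictee among u unmarked elements has a uniform rank in the order of next arrivals, and when
it returns at most the elements arriving after it are still unmarked. Since H_u = 1 + (H_0 + ... +
H_{u-1})/u, the random part costs at most H_u. So a chain costs at most 2 H_k, and the total is at
most 4 H_k OPT.

Using predictions (`isPotential_error`): a longest common subsequence supplies a set K of arrivals
that are predicted in the correct order and omits at most η of the predicted arrivals. Along the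
predicted part of a chain the representatives return later and later while their predicted times do
not increase, so at most one of these returns lies in K. A next arrival outside K pays 2, which
covers an eviction and leaves a saving; after ⌊H_k⌋ evictions the savings finance the random part
(`harmonic_add_inv_le`). Evicted elements that never return are paid from max(D - k, 0) ≤ OPT. The
total is L + max(D - k, 0) + 2η; misses add the final cache size, at most min(k, D). -/

theorem expect_pure {S : Type*} (s : S) (f : S → ℕ) : expect (PMF.pure s) f = f s := by
  unfold expect
  rw [tsum_eq_single s]
  · simp
  · intro b hb
    simp [PMF.pure_apply, hb]

theorem expect_bind {S T : Type*} (μ : PMF S) (κ : S → PMF T) (f : T → ℕ) :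
    expect (μ.bind κ) f = ∑' s, μ s * expect (κ s) f := by
  unfold expect
  simp only [PMF.bind_apply, ← ENNReal.tsum_mul_right, ← ENNReal.tsum_mul_left]
  rw [ENNReal.tsum_comm]
  simp only [mul_assoc]

theorem expect_uniformOfFinset_bind {S T : Type*} (U : Finset S) (hU : U.Nonempty)
    (κ : S → PMF T) (f : T → ℕ) :
    expect ((PMF.uniformOfFinset U hU).bind κ) f =
      (U.card : ℝ≥0∞)⁻¹ * ∑ e ∈ U, expect (κ e) f := by
  rw [expect_bind, tsum_eq_sum (s := U), Finset.mul_sum]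
  · refine Finset.sum_congr rfl fun e he => ?_
    rw [PMF.uniformOfFinset_apply_of_mem hU he]
  · intro e he
    rw [PMF.uniformOfFinset_apply_of_notMem hU he, zero_mul]

theorem expect_mono {S : Type*} (μ : PMF S) (f g : S → ℕ) (c : ℕ)
    (hfg : ∀ s ∈ μ.support, f s ≤ g s + c) : expect μ f ≤ expect μ g + c := by
  have h1 : (c : ℝ≥0∞) = ∑' s, μ s * c := by
    rw [ENNReal.tsum_mul_right, μ.tsum_coe, one_mul]
  unfold expect
  rw [h1, ← ENNReal.tsum_add]
  refine ENNReal.tsum_le_tsum fun s => ?_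
  by_cases hs : μ s = 0
  · simp [hs]
  · rw [← mul_add]
    gcongr
    exact_mod_cast hfg s ((PMF.mem_support_iff _ _).2 hs)

/-- The distribution of the final state when Predictive Marker is in the state `s` just before
the request at time `t`. -/
def run {α : Type*} (k : ℕ) {n : ℕ} (z : Fin n → α) (h : Fin n → ℝ) (tie : Fin n → ℕ)
    (t : ℕ) (s : State α) : PMF (State α) :=
  ((List.finRange n).drop t).foldl (fun μ t => μ.bind (step k (z t) (key h tie t))) (PMF.pure s)

/-- The Markov property: the fold appends requests at the end, while the induction over time peels
off the first one. -/
theorem foldl_bind_eq {S ι : Type*} (κ : ι → S → PMF S) (l : List ι) (μ : PMF S) :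
    l.foldl (fun μ t => μ.bind (κ t)) μ =
      μ.bind fun s => l.foldl (fun μ t => μ.bind (κ t)) (PMF.pure s) := by
  induction l generalizing μ with
  | nil => simp
  | cons a l ih =>
    simp only [List.foldl_cons]
    rw [ih, PMF.bind_bind]
    congr 1
    funext s
    rw [PMF.pure_bind, ← ih]

theorem run_of_le {α : Type*} (k : ℕ) {n : ℕ} (z : Fin n → α) (h : Fin n → ℝ) (tie : Fin n → ℕ)
    {t : ℕ} (ht : n ≤ t) (s : State α) : run k z h tie t s = PMF.pure s := by
  unfold run
  rw [List.drop_of_length_le (by simpa using ht)]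
  rfl

theorem run_of_lt {α : Type*} (k : ℕ) {n : ℕ} (z : Fin n → α) (h : Fin n → ℝ) (tie : Fin n → ℕ)
    {t : ℕ} (ht : t < n) (s : State α) :
    run k z h tie t s =
      (step k (z ⟨t, ht⟩) (key h tie ⟨t, ht⟩) s).bind (run k z h tie (t + 1)) := by
  unfold run
  rw [List.drop_eq_getElem_cons (by simpa using ht), List.foldl_cons, foldl_bind_eq]
  simp

theorem predictiveMarker_eq_run {α : Type*} (k : ℕ) {n : ℕ} (z : Fin n → α) (h : Fin n → ℝ)
    (tie : Fin n → ℕ) : predictiveMarker k z h tie = run k z h tie 0 (State.init α) := rfl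

/-! ### Edit distance and common sublists -/

/-- The entries matched by an optimal edit script form the common sublist; each edit loses at most
one entry of `xs`. -/
theorem exists_common_sublist {β : Type*} (xs ys : List β) :
    ∃ l : List β, l.Sublist xs ∧ l.Sublist ys ∧ xs.length ≤ l.length + editDist xs ys := by
  induction xs, ys using editDist.induct with
  | case1 ys => exact ⟨[], List.Sublist.refl _, by simp, by simp⟩
  | case2 x xs => exact ⟨[], by simp, by simp, by simp [editDist]⟩
  | case3 x xs y ys ih1 ih2 ih3 =>
    rw [editDist]
    obtain ⟨l1, a1, b1, c1⟩ := ih1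
    obtain ⟨l2, a2, b2, c2⟩ := ih2
    obtain ⟨l3, a3, b3, c3⟩ := ih3
    rcases min_choice (editDist xs (y :: ys) + 1)
      (min (editDist (x :: xs) ys + 1) (editDist xs ys + if x = y then 0 else 1)) with hm | hm
    · rw [hm]
      exact ⟨l1, a1.cons x, b1, by simp; omega⟩
    rw [hm]
    rcases min_choice (editDist (x :: xs) ys + 1)
      (editDist xs ys + if x = y then 0 else 1) with hm | hm
    · rw [hm]
      exact ⟨l2, a2, b2.cons y, by simp at c2 ⊢; omega⟩
    rw [hm]
    by_cases hxy : x = y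
    · subst hxy
      exact ⟨x :: l3, a3.cons_cons x, b3.cons_cons x, by simp; omega⟩
    · exact ⟨l3, a3.cons x, b3.cons y, by simp [hxy]; omega⟩

theorem mem_earlier {α : Type*} {n : ℕ} {z : Fin n → α} {s t : Fin n} :
    s ∈ earlier z t ↔ s < t ∧ z s = z t := by
  simp [earlier]

theorem arrival_injective {α : Type*} {n : ℕ} (z : Fin n → α) :
    Function.Injective (arrival z) := by
  have key : ∀ s t : Fin n, s < t → arrival z s ≠ arrival z t := by
    intro s t hst he
    simp only [arrival, Prod.mk.injEq] at he
    obtain ⟨h1, h2⟩ := he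
    have : earlier z s ⊂ earlier z t := by
      refine Finset.ssubset_iff_of_subset (fun a ha => ?_) |>.2 ⟨s, ?_, ?_⟩
      · rw [mem_earlier] at ha ⊢
        exact ⟨ha.1.trans hst, ha.2.trans h1⟩
      · exact mem_earlier.2 ⟨hst, h1⟩
      · simp [mem_earlier]
    have := Finset.card_lt_card this
    omega
  intro s t he
  rcases lt_trichotomy s t with h | h | h
  · exact (key s t h he).elim
  · exact h
  · exact (key t s h he.symm).elim

/-- The injective tie-breaker recovers the preceding arrival from its key, and two different
arrivals of an element cannot have the same immediate predecessor. -/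
theorem arrivalKey_injOn {α : Type*} {n : ℕ} (z : Fin n → α) (h : Fin n → ℝ) (tie : Fin n → ℕ)
    (htie : Function.Injective tie) :
    Set.InjOn (arrivalKey z h tie) {t | (earlier z t).Nonempty} := by
  intro s hs t ht he
  simp only [Set.mem_ofPred_eq] at hs ht
  rw [arrivalKey, arrivalKey, dif_pos hs, dif_pos ht] at he
  have hm : (earlier z s).max' hs = (earlier z t).max' ht := by
    have := congrArg (fun q : Key => (ofLex q).2) he
    exact htie this
  have h1 := mem_earlier.1 ((earlier z s).max'_mem hs)
  have h2 := mem_earlier.1 ((earlier z t).max'_mem ht)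
  have hz : z s = z t := by rw [← h1.2, hm, h2.2]
  rcases lt_trichotomy s t with hl | hl | hl
  · have := (earlier z t).le_max' s (mem_earlier.2 ⟨hl, hz⟩)
    rw [← hm] at this
    exact absurd h1.1 (not_lt.2 this)
  · exact hl
  · have := (earlier z s).le_max' t (mem_earlier.2 ⟨hl, hz.symm⟩)
    rw [hm] at this
    exact absurd h2.1 (not_lt.2 this)

/-- All but `editError` many predicted arrivals are predicted in the correct relative order. -/
theorem exists_monotone_arrivals {α : Type*} {n : ℕ} (z : Fin n → α) (h : Fin n → ℝ)
    (tie : Fin n → ℕ) (htie : Function.Injective tie) :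
    ∃ K : Finset (Fin n), (∀ s ∈ K, ∀ t ∈ K, s < t → arrivalKey z h tie s < arrivalKey z h tie t) ∧
      (Finset.univ.filter fun t => t ∉ K ∧ (earlier z t).Nonempty).card ≤ editError z h tie := by
  obtain ⟨l, h1, h2, h3⟩ := exists_common_sublist (trueSeq z) (predictedSeq z h tie)
  unfold trueSeq at h1
  unfold predictedSeq at h2
  obtain ⟨l1, a1, rfl⟩ := List.sublist_map_iff.1 h1
  obtain ⟨l2, a2, b2⟩ := List.sublist_map_iff.1 h2
  have hl : l1 = l2 := List.map_injective_iff.2 (arrival_injective z) b2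
  subst hl
  have hlt : l1.Pairwise (· < ·) :=
    List.Pairwise.sublist (a1.trans List.filter_sublist) (List.pairwise_lt_finRange n)
  have hle : l1.Pairwise fun s t => arrivalKey z h tie s ≤ arrivalKey z h tie t := by
    have : IsTrans (Fin n) fun s t => arrivalKey z h tie s ≤ arrivalKey z h tie t :=
      ⟨fun _ _ _ => le_trans⟩
    have : Std.Total fun s t : Fin n => arrivalKey z h tie s ≤ arrivalKey z h tie t :=
      ⟨fun _ _ => le_total _ _⟩
    exact List.Pairwise.sublist a2 (List.pairwise_insertionSort _ _)
  have hmem : ∀ s ∈ l1, (earlier z s).Nonempty := fun s hs => by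
    have := a1.subset hs
    simpa [predictedTimes] using this
  refine ⟨l1.toFinset, fun s hs t ht hst => ?_, ?_⟩
  · rw [List.mem_toFinset] at hs ht
    have hR : l1.Pairwise fun s t => (s < t → arrivalKey z h tie s ≤ arrivalKey z h tie t) ∧
        (t < s → arrivalKey z h tie t ≤ arrivalKey z h tie s) := by
      refine (hlt.and hle).imp fun ⟨p, q⟩ => ⟨fun _ => q, fun r => absurd p (not_lt.2 r.le)⟩
    have : Std.Symm fun s t : Fin n => (s < t → arrivalKey z h tie s ≤ arrivalKey z h tie t) ∧
        (t < s → arrivalKey z h tie t ≤ arrivalKey z h tie s) := ⟨fun _ _ h => ⟨h.2, h.1⟩⟩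
    refine lt_of_le_of_ne ((hR.forall hs ht hst.ne).1 hst) fun he => hst.ne ?_
    exact arrivalKey_injOn z h tie htie (hmem s hs) (hmem t ht) he
  · have hnd : (predictedTimes z).Nodup := (List.nodup_finRange n).filter _
    have e1 : (Finset.univ.filter fun t => t ∉ l1.toFinset ∧ (earlier z t).Nonempty) =
        (predictedTimes z).toFinset \ l1.toFinset := by
      ext t
      simp [predictedTimes, and_comm]
    have hsub : l1.toFinset ⊆ (predictedTimes z).toFinset := by
      intro t ht
      rw [List.mem_toFinset] at ht ⊢
      exact a1.subset ht
    rw [e1, Finset.card_sdiff_of_subset hsub, List.toFinset_card_of_nodup hnd,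
      List.toFinset_card_of_nodup (hlt.imp fun h => h.ne)]
    simp only [trueSeq, List.length_map] at h3
    unfold editError
    unfold trueSeq
    omega

/-! ### Next arrivals -/

/-- The time of the first request to `x` at time `t` or later, and `n` if there is none. -/
def nxt {α : Type*} {n : ℕ} (z : Fin n → α) (t : ℕ) (x : α) : ℕ :=
  sInf {τ | t ≤ τ ∧ (τ = n ∨ ∃ hτ : τ < n, z ⟨τ, hτ⟩ = x)}

/-- The element `x` is requested before time `t`. -/
def Seen {α : Type*} {n : ℕ} (z : Fin n → α) (t : ℕ) (x : α) : Prop :=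
  ∃ i : Fin n, i.1 < t ∧ z i = x

/-- The prediction of the arrival at time `τ`. -/
def arrivalKeyAt {α : Type*} {n : ℕ} (z : Fin n → α) (h : Fin n → ℝ) (tie : Fin n → ℕ)
    (τ : ℕ) : Key :=
  if hτ : τ < n then arrivalKey z h tie ⟨τ, hτ⟩ else toLex (0, 0)

section nxt

variable {α : Type*} {n : ℕ} {z : Fin n → α} {t : ℕ} {x : α}

theorem nxt_mem (ht : t ≤ n) :
    t ≤ nxt z t x ∧ (nxt z t x = n ∨ ∃ hτ : nxt z t x < n, z ⟨nxt z t x, hτ⟩ = x) :=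
  Nat.sInf_mem (s := {τ | t ≤ τ ∧ (τ = n ∨ ∃ hτ : τ < n, z ⟨τ, hτ⟩ = x)}) ⟨n, ht, Or.inl rfl⟩

theorem le_nxt (ht : t ≤ n) : t ≤ nxt z t x := (nxt_mem ht).1

theorem nxt_le (ht : t ≤ n) : nxt z t x ≤ n := Nat.sInf_le ⟨ht, Or.inl rfl⟩

theorem nxt_le_of_eq {τ : Fin n} (ht : t ≤ τ) (hx : z τ = x) : nxt z t x ≤ τ :=
  Nat.sInf_le ⟨ht, Or.inr ⟨τ.2, hx⟩⟩

theorem apply_nxt (ht : t ≤ n) (hx : nxt z t x < n) : z ⟨nxt z t x, hx⟩ = x := by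
  rcases (nxt_mem (z := z) (x := x) ht).2 with h | ⟨_, h⟩
  · exact absurd h hx.ne
  · exact h

theorem nxt_self (ht : t < n) : nxt z t (z ⟨t, ht⟩) = t :=
  le_antisymm (nxt_le_of_eq (τ := ⟨t, ht⟩) le_rfl rfl) (le_nxt ht.le)

theorem nxt_succ (ht : t < n) (hx : x ≠ z ⟨t, ht⟩) : nxt z (t + 1) x = nxt z t x := by
  unfold nxt
  congr 1
  ext τ
  constructor
  · rintro ⟨h1, h2⟩
    exact ⟨by omega, h2⟩
  · rintro ⟨h1, h2⟩
    refine ⟨?_, h2⟩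
    rcases Nat.lt_or_eq_of_le h1 with h | h
    · exact h
    · subst h
      rcases h2 with h2 | ⟨_, h2⟩
      · omega
      · exact absurd h2.symm hx

theorem nxt_inj {y : α} (ht : t ≤ n) (hx : nxt z t x < n) (hxy : nxt z t x = nxt z t y) :
    x = y := by
  have h1 := apply_nxt ht hx
  have h2 := apply_nxt ht (hxy ▸ hx : nxt z t y < n)
  rw [← h1, ← h2]
  congr 2

end nxt

/-- The stored predictions are those of the next arrivals. -/
def PredOk {α : Type*} {n : ℕ} (z : Fin n → α) (h : Fin n → ℝ) (tie : Fin n → ℕ)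
    (t : ℕ) (p : α → Key) : Prop :=
  ∀ x, Seen z t x → nxt z t x < n → p x = arrivalKeyAt z h tie (nxt z t x)

theorem PredOk.update {α : Type*} {n : ℕ} {z : Fin n → α} {h : Fin n → ℝ} {tie : Fin n → ℕ}
    {t : ℕ} {p : α → Key} (hp : PredOk z h tie t p) (ht : t < n) :
    PredOk z h tie (t + 1) (Function.update p (z ⟨t, ht⟩) (key h tie ⟨t, ht⟩)) := by
  intro x hs hx
  by_cases hxz : x = z ⟨t, ht⟩
  · have hax := apply_nxt (z := z) (x := x) (Nat.succ_le_of_lt ht) hx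
    have hle : t + 1 ≤ nxt z (t + 1) x := le_nxt (Nat.succ_le_of_lt ht)
    have hne : (earlier z ⟨nxt z (t + 1) x, hx⟩).Nonempty :=
      ⟨⟨t, ht⟩, mem_earlier.2 ⟨Fin.mk_lt_mk.2 (by omega), by rw [hax, hxz]⟩⟩
    -- A request to `x` strictly between `t` and its next arrival would contradict the minimality of
    -- `nxt`.
    have hmax : (earlier z ⟨nxt z (t + 1) x, hx⟩).max' hne = ⟨t, ht⟩ := by
      refine le_antisymm (Finset.max'_le _ _ _ fun i hi => ?_) (Finset.le_max' _ _
        (mem_earlier.2 ⟨Fin.mk_lt_mk.2 (by omega), by rw [hax, hxz]⟩))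
      rw [mem_earlier, hax] at hi
      by_contra hlt
      have h1 : t < i.1 := not_le.1 hlt
      have h2 := nxt_le_of_eq (z := z) (t := t + 1) (τ := i) h1 hi.2
      have h3 : i.1 < nxt z (t + 1) x := hi.1
      omega
    rw [arrivalKeyAt, dif_pos hx, arrivalKey, dif_pos hne, hmax, hxz, Function.update_self]
  · rw [Function.update_of_ne hxz]
    obtain ⟨i, hi, rfl⟩ := hs
    have hit : i.1 < t := by
      rcases Nat.lt_or_eq_of_le (Nat.le_of_lt_succ hi) with h | h
      · exact h
      · exact absurd (congrArg z (Fin.ext h)) hxz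
    rw [nxt_succ ht hxz] at hx ⊢
    exact hp _ ⟨i, hit, rfl⟩ hx

/-! ### Clean requests -/

/-- The number of requests to clean elements after the first phase, when `M` is the set of elements
requested in the current phase and `S` the set of those requested in the phase before. -/
def cleanCount {α : Type*} (k : ℕ) : List α → Finset α → Finset α → ℕ
  | [], _, _ => 0
  | z :: l, M, S =>
    if z ∈ M then cleanCount k l M S
    else if M.card = k then 1 + cleanCount k l {z} M
    else (if S.Nonempty ∧ z ∉ S then 1 else 0) + cleanCount k l (insert z M) S

/-- `cleanCount` for the requests from time `t` on. -/
def cleanFrom {α : Type*} (k : ℕ) {n : ℕ} (z : Fin n → α) (t : ℕ) (M S : Finset α) : ℕ :=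
  cleanCount k (((List.finRange n).drop t).map z) M S

section clean

variable {α : Type*} {k n : ℕ} {z : Fin n → α} {t : ℕ} {M S : Finset α}

theorem cleanFrom_of_le (ht : n ≤ t) : cleanFrom k z t M S = 0 := by
  unfold cleanFrom
  rw [List.drop_of_length_le (by simpa using ht)]
  rfl

theorem cleanFrom_eq (ht : t < n) : cleanFrom k z t M S =
    if z ⟨t, ht⟩ ∈ M then cleanFrom k z (t + 1) M S
    else if M.card = k then 1 + cleanFrom k z (t + 1) {z ⟨t, ht⟩} M
    else (if S.Nonempty ∧ z ⟨t, ht⟩ ∉ S then 1 else 0) +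
      cleanFrom k z (t + 1) (insert (z ⟨t, ht⟩) M) S := by
  unfold cleanFrom
  rw [List.drop_eq_getElem_cons (by simpa using ht), List.map_cons, cleanCount]
  simp

end clean

/-! ### Invariants of a run -/

/-- The greatest length of a chain all of whose representatives were chosen by prediction. -/
def detLen (k : ℕ) : ℕ := ⌊harmonic k⌋₊

/-- Properties of the cache, the marks and the chains that hold before every request. -/
structure Core {α : Type*} (k : ℕ) {n : ℕ} (z : Fin n → α) (h : Fin n → ℝ) (tie : Fin n → ℕ)
    (t : ℕ) (s : State α) : Prop where
  card_le : s.cache.card ≤ k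
  marked_subset : s.marked ⊆ s.cache
  cache_subset : s.cache ⊆ s.marked ∪ s.stale
  full : s.cache.card = k ∨ s.stale = ∅
  seen : ∀ x ∈ s.cache ∪ s.stale, Seen z t x
  one_le_len : ∀ e ∈ s.stale \ s.cache, 1 ≤ s.chainLen e
  -- Every extension of a chain also marks a new element. As `k - s.marked.card` elements are
  -- unmarked, this yields the hypothesis `c + U.card ≤ k` of `IsPotential.rand`.
  len_le : ∀ e ∈ s.stale \ s.cache, s.chainLen e ≤ s.marked.card
  -- The representative had the latest prediction among the unmarked elements when it was evicted;
  -- during the phase that set only shrinks and its predictions do not change.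
  ord : ∀ e ∈ s.stale \ s.cache, s.chainLen e ≤ detLen k → ∀ x ∈ s.cache \ s.marked,
    nxt z t e < n → nxt z t x < n →
      arrivalKeyAt z h tie (nxt z t x) ≤ arrivalKeyAt z h tie (nxt z t e)

/-- The number of elements of `U` whose next arrival comes after that of `e`. -/
def rank {α : Type*} {n : ℕ} (z : Fin n → α) (t : ℕ) (U : Finset α) (e : α) : ℕ :=
  (U.filter fun x => nxt z t e < nxt z t x).card

/-- A system of potentials for the analysis of Predictive Marker: `lam` is paid by every clean
request, `w τ` by the eviction of an element that next arrives at time `τ` out of the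
budget `G`, and `φ c τ r` is the potential of a chain of length `c` whose representative next
arrives at time `τ`, before exactly `r` of the unmarked elements of the cache. -/
structure IsPotential {α : Type*} (k : ℕ) {n : ℕ} (z : Fin n → α) (h : Fin n → ℝ)
    (tie : Fin n → ℕ) (lam : ℝ) (G : ℕ → Finset α → ℝ) (w : ℕ → ℝ) (φ : ℕ → ℕ → ℕ → ℝ) :
    Prop where
  lam_nonneg : 0 ≤ lam
  phi_nonneg : ∀ c τ r, 0 ≤ φ c τ r
  phi_mono : ∀ c τ r r', r ≤ r' → φ c τ r ≤ φ c τ r'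
  G_nonneg : ∀ t C, 0 ≤ G t C
  G_insert : ∀ t (ht : t < n) C, G (t + 1) (insert (z ⟨t, ht⟩) C) ≤ G t C
  G_evict : ∀ t (ht : t < n) C e, z ⟨t, ht⟩ ∉ C → C.card = k → e ∈ C →
    G (t + 1) ((insert (z ⟨t, ht⟩) C).erase e) + w (nxt z (t + 1) e) ≤ G t C
  clean : ∀ τ r, τ ≤ n → r < k → 1 + φ 1 τ r ≤ lam + w τ
  -- Here `τ₀` is the present time, at which the old representative returns, `τ` the next arrival of
  -- the new one, and `u` the number of unmarked elements.
  det : ∀ c τ₀ τ r u, 1 ≤ c → c + 1 ≤ detLen k → τ₀ < τ → τ ≤ n →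
    (τ < n → arrivalKeyAt z h tie τ ≤ arrivalKeyAt z h tie τ₀) → r < u →
    1 + φ (c + 1) τ r ≤ φ c τ₀ u + w τ
  rand : ∀ (U : Finset α) (T : α → ℕ) (c τ₀ : ℕ), 1 ≤ c → U.Nonempty → c + U.card ≤ k →
    detLen k ≤ c → τ₀ < n → (∀ e ∈ U, τ₀ < T e) → (∀ e ∈ U, T e ≤ n) →
    (∀ e ∈ U, ∀ e' ∈ U, T e < n → T e = T e' → e = e') →
    (c = detLen k → ∀ e ∈ U, T e < n → arrivalKeyAt z h tie (T e) ≤ arrivalKeyAt z h tie τ₀) →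
    ∑ e ∈ U, (1 + φ (c + 1) (T e) (U.filter fun x => T e < T x).card) ≤
      U.card * φ c τ₀ U.card + ∑ e ∈ U, w (T e)

/-- The bound on the expected final number of evictions given by a system of potentials. -/
def bound {α : Type*} (k : ℕ) {n : ℕ} (z : Fin n → α) (lam : ℝ) (G : ℕ → Finset α → ℝ)
    (φ : ℕ → ℕ → ℕ → ℝ) (t : ℕ) (s : State α) : ℝ :=
  s.evictions + lam * cleanFrom k z t s.marked s.stale + G t s.cache +
    ∑ e ∈ s.stale \ s.cache, φ (s.chainLen e) (nxt z t e) (rank z t (s.cache \ s.marked) e)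

/-! ### Effect of a single request on the invariants and the bound -/

section steps

variable {α : Type*} {k n : ℕ} {z : Fin n → α} {h : Fin n → ℝ} {tie : Fin n → ℕ}
  {lam : ℝ} {G : ℕ → Finset α → ℝ} {w : ℕ → ℝ} {φ : ℕ → ℕ → ℕ → ℝ} {t : ℕ} {s : State α}

theorem IsPotential.bound_nonneg (hP : IsPotential k z h tie lam G w φ) (t : ℕ) (s : State α) :
    0 ≤ bound k z lam G φ t s := by
  have h1 := hP.G_nonneg t s.cache
  have h2 := Finset.sum_nonneg fun e (_ : e ∈ s.stale \ s.cache) =>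
    hP.phi_nonneg (s.chainLen e) (nxt z t e) (rank z t (s.cache \ s.marked) e)
  have h3 := hP.lam_nonneg
  unfold bound
  positivity

theorem Seen.succ {x : α} (hx : Seen z t x) : Seen z (t + 1) x := by
  obtain ⟨i, hi, rfl⟩ := hx
  exact ⟨i, by omega, rfl⟩

theorem rank_mono {U V : Finset α} (hUV : U ⊆ V) (e : α) : rank z t U e ≤ rank z t V e :=
  Finset.card_le_card (Finset.filter_subset_filter _ hUV)

theorem rank_succ {U : Finset α} {e : α} (ht : t < n) (hz : z ⟨t, ht⟩ ∉ U) (he : e ≠ z ⟨t, ht⟩) :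
    rank z (t + 1) U e = rank z t U e := by
  unfold rank
  congr 1
  refine Finset.filter_congr fun x hx => ?_
  rw [nxt_succ ht he, nxt_succ ht (ne_of_mem_of_not_mem hx hz)]

theorem rank_lt {U : Finset α} {e : α} (he : e ∈ U) : rank z t U e < U.card :=
  Finset.card_lt_card <| Finset.filter_ssubset.2 ⟨e, he, lt_irrefl _⟩

theorem rank_self {U : Finset α} (ht : t < n) (hz : z ⟨t, ht⟩ ∉ U) :
    rank z t U (z ⟨t, ht⟩) = U.card := by
  unfold rank
  rw [Finset.filter_true_of_mem]
  intro x hx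
  rw [nxt_self, ← nxt_succ ht (ne_of_mem_of_not_mem hx hz)]
  exact le_nxt (Nat.succ_le_of_lt ht)

theorem Core.hit (hs : Core k z h tie t s) (ht : t < n) (hz : z ⟨t, ht⟩ ∈ s.cache) (p : α → Key) :
    Core k z h tie (t + 1) { s with pred := p, marked := insert (z ⟨t, ht⟩) s.marked } where
  card_le := hs.card_le
  marked_subset := Finset.insert_subset hz hs.marked_subset
  cache_subset := hs.cache_subset.trans
    (Finset.union_subset_union_left (Finset.subset_insert _ _))
  full := hs.full
  seen := fun x hx => (hs.seen x hx).succ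
  one_le_len := hs.one_le_len
  len_le := fun e he => (hs.len_le e he).trans (Finset.card_le_card (Finset.subset_insert _ _))
  ord := by
    intro e he hl x hx
    have hxz : x ≠ z ⟨t, ht⟩ := by
      rintro rfl
      simp at hx
    have hez : e ≠ z ⟨t, ht⟩ := by
      rintro rfl
      exact (Finset.mem_sdiff.1 he).2 hz
    rw [nxt_succ ht hxz, nxt_succ ht hez]
    refine hs.ord e he hl x ?_
    simp only [Finset.mem_sdiff, Finset.mem_insert, not_or] at hx ⊢
    exact ⟨hx.1, hx.2.2⟩

/-- A hit on an unmarked element neither starts a phase nor is clean, since the element is stale.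
Marking it can only lower ranks. -/
theorem Core.bound_hit (hs : Core k z h tie t s) (hP : IsPotential k z h tie lam G w φ)
    (ht : t < n) (hz : z ⟨t, ht⟩ ∈ s.cache) (p : α → Key) :
    bound k z lam G φ (t + 1) { s with pred := p, marked := insert (z ⟨t, ht⟩) s.marked } ≤
      bound k z lam G φ t s := by
  have hc : cleanFrom k z (t + 1) (insert (z ⟨t, ht⟩) s.marked) s.stale =
      cleanFrom k z t s.marked s.stale := by
    rw [cleanFrom_eq ht]
    by_cases hm : z ⟨t, ht⟩ ∈ s.marked
    · rw [if_pos hm, Finset.insert_eq_of_mem hm]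
    · have h1 : s.marked.card < s.cache.card := Finset.card_lt_card
        (Finset.ssubset_iff_of_subset hs.marked_subset |>.2 ⟨_, hz, hm⟩)
      have h2 := hs.card_le
      have h3 : z ⟨t, ht⟩ ∈ s.stale := by
        have := hs.cache_subset hz
        simpa [hm] using this
      rw [if_neg hm, if_neg (by omega), if_neg (by simp [h3]), zero_add]
  unfold bound
  dsimp only
  rw [hc]
  have hG := hP.G_insert t ht s.cache
  rw [Finset.insert_eq_of_mem hz] at hG
  gcongr with e he
  have hez : e ≠ z ⟨t, ht⟩ := by
    rintro rfl
    exact (Finset.mem_sdiff.1 he).2 hz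
  rw [nxt_succ ht hez]
  refine hP.phi_mono _ _ _ _ ?_
  rw [rank_succ ht (by simp) hez]
  exact rank_mono (Finset.sdiff_subset_sdiff le_rfl (Finset.subset_insert _ _)) e

theorem Core.marked_eq (hs : Core k z h tie t s) (hS : s.stale = ∅) : s.marked = s.cache :=
  le_antisymm hs.marked_subset (by simpa [hS] using hs.cache_subset)

/-- A cache that is not full occurs only in the first phase, where nothing is stale and everything
cached is marked, so the conditions on chains are void. -/
theorem Core.fill (hs : Core k z h tie t s) (ht : t < n) (hc : s.cache.card < k)
    (p : α → Key) (m : ℕ) :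
    Core k z h tie (t + 1) { s with
      pred := p
      cache := insert (z ⟨t, ht⟩) s.cache
      marked := insert (z ⟨t, ht⟩) s.marked
      misses := m } := by
  have hS : s.stale = ∅ := hs.full.resolve_left hc.ne
  have hM := hs.marked_eq hS
  constructor <;> simp only [hS, hM, Finset.empty_sdiff, Finset.notMem_empty, false_imp_iff,
    implies_true, or_true, le_refl, Finset.union_empty]
  · exact (Finset.card_insert_le _ _).trans hc
  · intro x hx
    rcases Finset.mem_insert.1 hx with rfl | hx
    · exact ⟨_, Nat.lt_succ_self _, rfl⟩
    · exact (hs.seen x (Finset.mem_union_left _ hx)).succ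

theorem Core.bound_fill (hs : Core k z h tie t s) (hP : IsPotential k z h tie lam G w φ)
    (ht : t < n) (hz : z ⟨t, ht⟩ ∉ s.cache) (hc : s.cache.card < k) (p : α → Key) (m : ℕ) :
    bound k z lam G φ (t + 1) { s with
      pred := p
      cache := insert (z ⟨t, ht⟩) s.cache
      marked := insert (z ⟨t, ht⟩) s.marked
      misses := m } ≤ bound k z lam G φ t s := by
  have hS : s.stale = ∅ := hs.full.resolve_left hc.ne
  have hM := hs.marked_eq hS
  have hcl : cleanFrom k z (t + 1) (insert (z ⟨t, ht⟩) s.marked) s.stale =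
      cleanFrom k z t s.marked s.stale := by
    rw [cleanFrom_eq ht, hM, if_neg hz, if_neg hc.ne, if_neg (by simp [hS]), zero_add]
  unfold bound
  dsimp only
  rw [hcl, hS, Finset.empty_sdiff, Finset.sum_empty, Finset.empty_sdiff, Finset.sum_empty]
  have hG := hP.G_insert t ht s.cache
  gcongr

theorem Core.newPhase (hs : Core k z h tie t s) (hc : s.cache.card = k) :
    Core k z h tie t (s.newPhase k) := by
  unfold State.newPhase
  split_ifs
  · constructor <;> simp only [Finset.sdiff_self, Finset.notMem_empty, false_imp_iff, implies_true,
      Finset.empty_subset, Finset.empty_union, Finset.union_idempotent, le_refl, hc, true_or]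
    intro x hx
    exact hs.seen x (Finset.mem_union_left _ hx)
  · exact hs

/-- The request that opens a phase is clean and counted once, whether the sets are read before or
after the reset. Discarding the old chains only removes nonnegative terms. -/
theorem Core.bound_newPhase (hs : Core k z h tie t s) (hP : IsPotential k z h tie lam G w φ)
    (hk : 0 < k) (ht : t < n) (hz : z ⟨t, ht⟩ ∉ s.cache) (hc : s.cache.card = k) :
    bound k z lam G φ t (s.newPhase k) ≤ bound k z lam G φ t s := by
  unfold State.newPhase
  split_ifs with hm
  · have hM : s.marked = s.cache :=
      Finset.eq_of_subset_of_card_le hs.marked_subset (by omega)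
    have hne : s.cache.Nonempty := Finset.card_pos.1 (by omega)
    have hcl : cleanFrom k z t ∅ s.cache = cleanFrom k z t s.marked s.stale := by
      rw [cleanFrom_eq ht, cleanFrom_eq (M := s.marked) ht, hM, if_neg hz, if_pos hc,
        if_neg (by simp), if_neg (by simp; omega), if_pos ⟨hne, hz⟩]
      rfl
    unfold bound
    dsimp only
    rw [hcl, Finset.sdiff_self, Finset.sum_empty]
    gcongr
    exact Finset.sum_nonneg fun e _ => hP.phi_nonneg _ _ _
  · exact le_rfl

theorem newPhase_cache : (s.newPhase k).cache = s.cache := by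
  unfold State.newPhase
  split_ifs <;> rfl

theorem newPhase_pred : (s.newPhase k).pred = s.pred := by
  unfold State.newPhase
  split_ifs <;> rfl

theorem Core.card_marked_newPhase_lt (hs : Core k z h tie t s) (hk : 0 < k) :
    (s.newPhase k).marked.card < k := by
  unfold State.newPhase
  split_ifs with hm
  · simpa using hk
  · exact lt_of_le_of_ne ((Finset.card_le_card hs.marked_subset).trans hs.card_le) hm

theorem Core.replace (hs : Core k z h tie t s) (ht : t < n) (hz : z ⟨t, ht⟩ ∉ s.cache)
    (hc : s.cache.card = k) {e : α} (he : e ∈ s.cache \ s.marked)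
    (hord : s.newLen (z ⟨t, ht⟩) ≤ detLen k → ∀ x ∈ s.cache \ s.marked,
      nxt z (t + 1) e < n → nxt z (t + 1) x < n →
        arrivalKeyAt z h tie (nxt z (t + 1) x) ≤ arrivalKeyAt z h tie (nxt z (t + 1) e)) :
    Core k z h tie (t + 1) (s.replace (z ⟨t, ht⟩) e) := by
  obtain ⟨heC, heM⟩ := Finset.mem_sdiff.1 he
  have hez : e ≠ z ⟨t, ht⟩ := ne_of_mem_of_not_mem heC hz
  have hzM : z ⟨t, ht⟩ ∉ s.marked := fun hm => hz (hs.marked_subset hm)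
  have hcard : ((insert (z ⟨t, ht⟩) s.cache).erase e).card = k := by
    rw [Finset.card_erase_of_mem (Finset.mem_insert_of_mem heC), Finset.card_insert_of_notMem hz,
      hc, Nat.add_sub_cancel]
  -- Among the stale elements outside the cache, the requested one leaves and `e` joins.
  have hcases : ∀ x ∈ s.stale \ (insert (z ⟨t, ht⟩) s.cache).erase e,
      x = e ∨ x ≠ e ∧ x ≠ z ⟨t, ht⟩ ∧ x ∈ s.stale \ s.cache := by
    intro x hx
    simp only [Finset.mem_sdiff, Finset.mem_erase, Finset.mem_insert] at hx ⊢
    tauto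
  constructor <;> simp only [State.replace]
  · exact hcard.le
  · intro x hx
    rw [Finset.mem_erase]
    rcases Finset.mem_insert.1 hx with rfl | hx
    · exact ⟨hez.symm, Finset.mem_insert_self _ _⟩
    · exact ⟨ne_of_mem_of_not_mem hx heM, Finset.mem_insert_of_mem (hs.marked_subset hx)⟩
  · intro x hx
    have := @hs.cache_subset x
    simp only [Finset.mem_erase, Finset.mem_union, Finset.mem_insert] at hx this ⊢
    tauto
  · exact Or.inl hcard
  · intro x hx
    have : x = z ⟨t, ht⟩ ∨ x ∈ s.cache ∪ s.stale := by
      simp only [Finset.mem_erase, Finset.mem_union, Finset.mem_insert] at hx ⊢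
      tauto
    rcases this with rfl | hx
    · exact ⟨_, Nat.lt_succ_self _, rfl⟩
    · exact (hs.seen x hx).succ
  · intro x hx
    rcases hcases x hx with rfl | ⟨hxe, hxz, hx⟩
    · rw [Function.update_self, State.newLen]
      split_ifs <;> omega
    · rw [Function.update_of_ne hxe]
      exact hs.one_le_len x hx
  · intro x hx
    rw [Finset.card_insert_of_notMem hzM]
    rcases hcases x hx with rfl | ⟨hxe, hxz, hx⟩
    · rw [Function.update_self, State.newLen]
      split_ifs with hzS
      · have := hs.len_le _ (Finset.mem_sdiff.2 ⟨hzS, hz⟩)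
        omega
      · omega
    · rw [Function.update_of_ne hxe]
      have := hs.len_le x hx
      omega
  · intro y hy hl x hx
    have hx' : x ∈ s.cache \ s.marked ∧ x ≠ z ⟨t, ht⟩ := by
      simp only [Finset.mem_sdiff, Finset.mem_erase, Finset.mem_insert] at hx ⊢
      tauto
    rcases hcases y hy with rfl | ⟨hye, hyz, hy⟩
    · rw [Function.update_self] at hl
      exact hord hl x hx'.1
    · rw [Function.update_of_ne hye] at hl
      rw [nxt_succ ht hyz, nxt_succ ht hx'.2]
      exact hs.ord y hy hl x hx'.1

/-- The part of the bound that is not affected by the miss at time `t`. -/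
def restBound {α : Type*} (k : ℕ) {n : ℕ} (z : Fin n → α) (lam : ℝ) (G : ℕ → Finset α → ℝ)
    (φ : ℕ → ℕ → ℕ → ℝ) (t : ℕ) (s : State α) (x : α) : ℝ :=
  s.evictions + lam * cleanFrom k z (t + 1) (insert x s.marked) s.stale + G t s.cache +
    ∑ e ∈ (s.stale \ s.cache).erase x,
      φ (s.chainLen e) (nxt z t e) (rank z t (s.cache \ s.marked) e)

/-- The other chains keep length and next arrival, and their ranks do not grow because the set of
unmarked elements shrinks. With `Core.bound_eq` this reduces a miss to one of the inequalities
`clean`, `det`, `rand`. -/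
theorem Core.bound_replace (hs : Core k z h tie t s) (hP : IsPotential k z h tie lam G w φ)
    (ht : t < n) (hz : z ⟨t, ht⟩ ∉ s.cache)
    (hc : s.cache.card = k) {e : α} (he : e ∈ s.cache \ s.marked) :
    bound k z lam G φ (t + 1) (s.replace (z ⟨t, ht⟩) e) ≤
      restBound k z lam G φ t s (z ⟨t, ht⟩) + (1 - w (nxt z (t + 1) e) +
        φ (s.newLen (z ⟨t, ht⟩)) (nxt z (t + 1) e)
          (rank z (t + 1) (s.cache \ s.marked) e)) := by
  obtain ⟨heC, heM⟩ := Finset.mem_sdiff.1 he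
  have hez : e ≠ z ⟨t, ht⟩ := ne_of_mem_of_not_mem heC hz
  have heS : e ∈ s.stale := by
    have := hs.cache_subset heC
    simpa [heM] using this
  have hG := hP.G_evict t ht s.cache e hz hc heC
  have hset : s.stale \ (insert (z ⟨t, ht⟩) s.cache).erase e =
      insert e ((s.stale \ s.cache).erase (z ⟨t, ht⟩)) := by
    ext x
    simp only [Finset.mem_sdiff, Finset.mem_erase, Finset.mem_insert]
    by_cases hxe : x = e
    · simp [hxe, heS]
    · simp only [hxe]
      tauto
  have hU : (insert (z ⟨t, ht⟩) s.cache).erase e \ insert (z ⟨t, ht⟩) s.marked ⊆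
      s.cache \ s.marked := by
    intro x hx
    simp only [Finset.mem_sdiff, Finset.mem_erase, Finset.mem_insert] at hx ⊢
    tauto
  unfold bound restBound
  simp only [State.replace]
  rw [hset, Finset.sum_insert (by simp [heC]), Function.update_self]
  have h1 := hP.phi_mono (s.newLen (z ⟨t, ht⟩)) (nxt z (t + 1) e) _ _
    (rank_mono (z := z) (t := t + 1) hU e)
  have h2 : ∑ x ∈ (s.stale \ s.cache).erase (z ⟨t, ht⟩),
      φ (Function.update s.chainLen e (s.newLen (z ⟨t, ht⟩)) x) (nxt z (t + 1) x)
        (rank z (t + 1) ((insert (z ⟨t, ht⟩) s.cache).erase e \ insert (z ⟨t, ht⟩) s.marked) x) ≤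
      ∑ x ∈ (s.stale \ s.cache).erase (z ⟨t, ht⟩),
        φ (s.chainLen x) (nxt z t x) (rank z t (s.cache \ s.marked) x) := by
    refine Finset.sum_le_sum fun x hx => ?_
    rw [Finset.mem_erase, Finset.mem_sdiff] at hx
    rw [Function.update_of_ne (ne_of_mem_of_not_mem heC hx.2.2).symm, nxt_succ ht hx.1]
    refine hP.phi_mono _ _ _ _ ?_
    rw [← rank_succ ht (by simp [hz]) hx.1]
    exact rank_mono hU x
  push_cast
  linarith

/-- Isolates what pays for the miss: the potential of the chain being extended, with full rank since
its representative arrives now, or the price of a clean request. -/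
theorem Core.bound_eq (hs : Core k z h tie t s) (ht : t < n) (hz : z ⟨t, ht⟩ ∉ s.cache)
    (hc : s.cache.card = k) (hm : s.marked.card < k) :
    bound k z lam G φ t s = restBound k z lam G φ t s (z ⟨t, ht⟩) +
      if z ⟨t, ht⟩ ∈ s.stale then φ (s.chainLen (z ⟨t, ht⟩)) t (s.cache \ s.marked).card
      else lam := by
  have hzM : z ⟨t, ht⟩ ∉ s.marked := fun hm => hz (hs.marked_subset hm)
  have hS : s.stale.Nonempty := by
    rw [Finset.nonempty_iff_ne_empty]
    intro h0
    rw [hs.marked_eq h0] at hm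
    omega
  have hcl := cleanFrom_eq (k := k) (z := z) (M := s.marked) (S := s.stale) ht
  rw [if_neg hzM, if_neg hm.ne] at hcl
  unfold bound restBound
  by_cases hzS : z ⟨t, ht⟩ ∈ s.stale
  · rw [if_pos hzS, hcl, if_neg (by simp [hzS]), zero_add,
      ← Finset.sum_erase_add _ _ (Finset.mem_sdiff.2 ⟨hzS, hz⟩), nxt_self,
      rank_self ht (by simp [hz])]
    ring
  · rw [if_neg hzS, hcl, if_pos ⟨hS, hzS⟩, Finset.erase_eq_of_notMem (by simp [hzS])]
    push_cast
    ring

theorem argmaxPred_mem (p : α → Key) (U : Finset α) (hU : U.Nonempty) : argmaxPred p U hU ∈ U :=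
  (U.exists_max_image p hU).choose_spec.1

theorem le_argmaxPred (p : α → Key) (U : Finset α) (hU : U.Nonempty) {x : α} (hx : x ∈ U) :
    p x ≤ p (argmaxPred p U hU) :=
  (U.exists_max_image p hU).choose_spec.2 x hx

theorem PredOk.arrivalKeyAt_le {p : α → Key} (hp : PredOk z h tie t p) {U : Finset α}
    (hU : U.Nonempty) (hseen : ∀ x ∈ U, Seen z t x) {x : α} (hx : x ∈ U)
    (h1 : nxt z t (argmaxPred p U hU) < n) (h2 : nxt z t x < n) :
    arrivalKeyAt z h tie (nxt z t x) ≤ arrivalKeyAt z h tie (nxt z t (argmaxPred p U hU)) := by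
  rw [← hp x (hseen x hx) h2, ← hp _ (hseen _ (argmaxPred_mem p U hU)) h1]
  exact le_argmaxPred p U hU hx

/-- A miss with a full cache and an unmarked element does not increase the bound in expectation. -/
theorem expect_evict_le (hk : 0 < k) (hP : IsPotential k z h tie lam G w φ)
    (hs : Core k z h tie t s) (hp : PredOk z h tie (t + 1) s.pred) (ht : t < n)
    (hz : z ⟨t, ht⟩ ∉ s.cache) (hc : s.cache.card = k) (hm : s.marked.card < k)
    (ih : ∀ s', Core k z h tie (t + 1) s' → PredOk z h tie (t + 1) s'.pred →
      expect (run k z h tie (t + 1) s') State.evictions ≤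
        ENNReal.ofReal (bound k z lam G φ (t + 1) s')) :
    expect (((s.evictee k (z ⟨t, ht⟩)).map (s.replace (z ⟨t, ht⟩))).bind (run k z h tie (t + 1)))
      State.evictions ≤ ENNReal.ofReal (bound k z lam G φ t s) := by
  have hUcard : (s.cache \ s.marked).card = k - s.marked.card := by
    rw [Finset.card_sdiff_of_subset hs.marked_subset, hc]
  have hU : (s.cache \ s.marked).Nonempty := Finset.card_pos.1 (by omega)
  have hzU : z ⟨t, ht⟩ ∉ s.cache \ s.marked := by simp [hz]
  have hseen : ∀ x ∈ s.cache \ s.marked, Seen z (t + 1) x := fun x hx =>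
    (hs.seen x (Finset.mem_union_left _ (Finset.mem_sdiff.1 hx).1)).succ
  -- The algorithm compares lengths with the rational number H_k, the potentials with its floor.
  have hdet : ∀ m : ℕ, (m : ℚ) ≤ harmonic k ↔ m ≤ detLen k := fun m => by
    refine (Nat.le_floor_iff ?_).symm
    unfold harmonic
    positivity
  rw [hs.bound_eq ht hz hc hm, PMF.bind_map]
  unfold State.evictee
  rw [dif_pos hU]
  split_ifs with hcond hzS hzS
  · -- a stale element in a short chain
    rw [PMF.pure_bind]
    have hl : s.newLen (z ⟨t, ht⟩) = s.chainLen (z ⟨t, ht⟩) + 1 := by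
      rw [State.newLen, if_pos hzS]
    rw [hdet, hl] at hcond
    have he := argmaxPred_mem s.pred _ hU
    have hlen : s.chainLen (z ⟨t, ht⟩) + 1 ≤ detLen k := hcond.resolve_left (by simp [hzS])
    refine (ih _ (hs.replace ht hz hc he fun _ x hx h1 h2 =>
      hp.arrivalKeyAt_le hU hseen hx h1 h2) hp).trans (ENNReal.ofReal_le_ofReal ?_)
    refine (hs.bound_replace hP ht hz hc he).trans (add_le_add le_rfl ?_)
    rw [hl]
    have hzSC : z ⟨t, ht⟩ ∈ s.stale \ s.cache := Finset.mem_sdiff.2 ⟨hzS, hz⟩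
    have hez := ne_of_mem_of_not_mem he hzU
    have := hP.det (s.chainLen (z ⟨t, ht⟩)) t
      (nxt z (t + 1) (argmaxPred s.pred (s.cache \ s.marked) hU))
      (rank z (t + 1) (s.cache \ s.marked) (argmaxPred s.pred (s.cache \ s.marked) hU))
      (s.cache \ s.marked).card (hs.one_le_len _ hzSC) hlen
      (le_nxt (Nat.succ_le_of_lt ht)) (nxt_le (Nat.succ_le_of_lt ht)) (fun hlt => by
        have := hs.ord _ hzSC (by omega) _ he (by rwa [nxt_self]) (by rwa [← nxt_succ ht hez])
        rwa [nxt_self, ← nxt_succ ht hez] at this) (rank_lt he)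
    linarith
  · -- a clean element
    rw [PMF.pure_bind]
    have hl : s.newLen (z ⟨t, ht⟩) = 1 := by
      rw [State.newLen, if_neg hzS]
    have he := argmaxPred_mem s.pred _ hU
    refine (ih _ (hs.replace ht hz hc he fun _ x hx h1 h2 =>
      hp.arrivalKeyAt_le hU hseen hx h1 h2) hp).trans (ENNReal.ofReal_le_ofReal ?_)
    refine (hs.bound_replace hP ht hz hc he).trans (add_le_add le_rfl ?_)
    rw [hl]
    have hr := rank_lt (z := z) (t := t + 1) he
    have := hP.clean (nxt z (t + 1) (argmaxPred s.pred (s.cache \ s.marked) hU))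
      (rank z (t + 1) (s.cache \ s.marked) (argmaxPred s.pred (s.cache \ s.marked) hU))
      (nxt_le (Nat.succ_le_of_lt ht)) (by omega)
    linarith
  · -- a stale element in a long chain
    rw [expect_uniformOfFinset_bind]
    have hl : s.newLen (z ⟨t, ht⟩) = s.chainLen (z ⟨t, ht⟩) + 1 := by
      rw [State.newLen, if_pos hzS]
    rw [hdet, hl] at hcond
    push Not at hcond
    have hzSC : z ⟨t, ht⟩ ∈ s.stale \ s.cache := Finset.mem_sdiff.2 ⟨hzS, hz⟩
    set u := (s.cache \ s.marked).card with hu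
    have hu0 : 0 < u := Finset.card_pos.2 hU
    have hne : ∀ e ∈ s.cache \ s.marked, e ≠ z ⟨t, ht⟩ := fun e he => ne_of_mem_of_not_mem he hzU
    have key := hP.rand (s.cache \ s.marked) (nxt z (t + 1)) (s.chainLen (z ⟨t, ht⟩)) t
      (hs.one_le_len _ hzSC) hU (by have := hs.len_le _ hzSC; omega) (by omega) ht
      (fun e _ => le_nxt (Nat.succ_le_of_lt ht)) (fun e _ => nxt_le (Nat.succ_le_of_lt ht))
      (fun e _ e' _ h1 h2 => nxt_inj (Nat.succ_le_of_lt ht) h1 h2) (fun hcl e he hlt => by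
        rw [nxt_succ ht (hne e he)] at hlt ⊢
        have := hs.ord _ hzSC hcl.le _ he (by rwa [nxt_self]) hlt
        rwa [nxt_self] at this)
    have hsum : ∑ e ∈ s.cache \ s.marked,
        expect (run k z h tie (t + 1) (s.replace (z ⟨t, ht⟩) e)) State.evictions ≤
        ∑ e ∈ s.cache \ s.marked, ENNReal.ofReal (restBound k z lam G φ t s (z ⟨t, ht⟩) +
          (1 - w (nxt z (t + 1) e) + φ (s.chainLen (z ⟨t, ht⟩) + 1) (nxt z (t + 1) e)
            (rank z (t + 1) (s.cache \ s.marked) e))) := by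
      refine Finset.sum_le_sum fun e he => ?_
      -- The new length exceeds `detLen k`, so no order condition is required of a random evictee.
      refine (ih _ (hs.replace ht hz hc he fun hle => absurd hle ?_) hp).trans
        (ENNReal.ofReal_le_ofReal ?_)
      · rw [hl]
        omega
      · rw [← hl]
        exact hs.bound_replace hP ht hz hc he
    -- `ENNReal.ofReal` is additive only on nonnegative summands; each one dominates the nonnegative
    -- bound of a successor state.
    have hnn : ∀ e ∈ s.cache \ s.marked, 0 ≤ restBound k z lam G φ t s (z ⟨t, ht⟩) +
        (1 - w (nxt z (t + 1) e) + φ (s.chainLen (z ⟨t, ht⟩) + 1) (nxt z (t + 1) e)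
          (rank z (t + 1) (s.cache \ s.marked) e)) := fun e he => by
      rw [← hl]
      exact (hP.bound_nonneg _ _).trans (hs.bound_replace hP ht hz hc he)
    rw [← ENNReal.ofReal_sum_of_nonneg hnn] at hsum
    have hu0' : (0 : ℝ) < u := by exact_mod_cast hu0
    have hinv : (u : ℝ≥0∞)⁻¹ = ENNReal.ofReal (u : ℝ)⁻¹ := by
      rw [ENNReal.ofReal_inv_of_pos hu0', ENNReal.ofReal_natCast]
    refine (mul_le_mul_right hsum _).trans ?_
    rw [hinv, ← ENNReal.ofReal_mul (by positivity)]
    refine ENNReal.ofReal_le_ofReal ?_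
    rw [inv_mul_le_iff₀ hu0', Finset.sum_add_distrib, Finset.sum_const, ← hu, nsmul_eq_mul,
      mul_add]
    refine add_le_add le_rfl ?_
    have hsplit : ∑ e ∈ s.cache \ s.marked, (1 - w (nxt z (t + 1) e) +
        φ (s.chainLen (z ⟨t, ht⟩) + 1) (nxt z (t + 1) e)
          (rank z (t + 1) (s.cache \ s.marked) e)) =
        ∑ e ∈ s.cache \ s.marked, (1 + φ (s.chainLen (z ⟨t, ht⟩) + 1) (nxt z (t + 1) e)
          (rank z (t + 1) (s.cache \ s.marked) e)) -
        ∑ e ∈ s.cache \ s.marked, w (nxt z (t + 1) e) := by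
      rw [← Finset.sum_sub_distrib]
      exact Finset.sum_congr rfl fun e _ => by ring
    rw [hsplit]
    unfold rank
    linarith
  · exact absurd (Or.inl hzS) hcond

/-- A system of potentials bounds the expected number of evictions. -/
theorem expect_run_le (hk : 0 < k) (hP : IsPotential k z h tie lam G w φ) (t : ℕ) (ht : t ≤ n) :
    ∀ s : State α, Core k z h tie t s → PredOk z h tie t s.pred →
      expect (run k z h tie t s) State.evictions ≤ ENNReal.ofReal (bound k z lam G φ t s) := by
  induction ht using Nat.decreasingInduction with
  | self =>
    intro s hs hp
    rw [run_of_le k z h tie le_rfl, expect_pure, ← ENNReal.ofReal_natCast]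
    refine ENNReal.ofReal_le_ofReal ?_
    unfold bound
    rw [cleanFrom_of_le le_rfl]
    have := hP.G_nonneg n s.cache
    have := Finset.sum_nonneg fun e (_ : e ∈ s.stale \ s.cache) =>
      hP.phi_nonneg (s.chainLen e) (nxt z n e) (rank z n (s.cache \ s.marked) e)
    push_cast
    linarith
  | of_succ t ht ih =>
    intro s hs hp
    have hp' := hp.update ht
    rw [run_of_lt k z h tie ht]
    unfold step
    dsimp only
    split_ifs with h1 h2
    · rw [PMF.pure_bind]
      exact (ih _ (hs.hit ht h1 _) hp').trans
        (ENNReal.ofReal_le_ofReal (hs.bound_hit hP ht h1 _))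
    · rw [PMF.pure_bind]
      exact (ih _ (hs.fill ht h2 _ _) hp').trans
        (ENNReal.ofReal_le_ofReal (hs.bound_fill hP ht h1 h2 _ _))
    · have hc : s.cache.card = k := le_antisymm hs.card_le (not_lt.1 h2)
      set s₁ : State α :=
        { s with pred := Function.update s.pred (z ⟨t, ht⟩) (key h tie ⟨t, ht⟩) } with hs₁
      have hcore : Core k z h tie t s₁ := { hs with }
      refine (expect_evict_le hk hP (hcore.newPhase hc) (by rwa [newPhase_pred]) ht
        (by rwa [newPhase_cache]) (by rwa [newPhase_cache]) (hcore.card_marked_newPhase_lt hk)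
        ih).trans (ENNReal.ofReal_le_ofReal ?_)
      exact hcore.bound_newPhase hP hk ht h1 hc

end steps

/-! ### Harmonic numbers -/

theorem harmonic_mono {i j : ℕ} (hij : i ≤ j) : (harmonic i : ℝ) ≤ harmonic j := by
  have : harmonic i ≤ harmonic j := by
    unfold harmonic
    exact Finset.sum_le_sum_of_subset_of_nonneg (Finset.range_subset_range.2 hij)
      fun i _ _ => by positivity
  exact_mod_cast this

theorem harmonic_nonneg (i : ℕ) : (0 : ℝ) ≤ harmonic i := by
  simpa using harmonic_mono (Nat.zero_le i)

theorem one_le_harmonic {k : ℕ} (hk : 0 < k) : (1 : ℝ) ≤ harmonic k := by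
  simpa using harmonic_mono (Nat.succ_le_of_lt hk)

theorem harmonic_succ_real (i : ℕ) : (harmonic (i + 1) : ℝ) = harmonic i + ((i : ℝ) + 1)⁻¹ := by
  rw [harmonic_succ]
  push_cast
  rfl

/-- The recursion behind random evictions: the average of H_j over the ranks j < u is H_u - 1, which
leaves one unit for the eviction. -/
theorem sum_range_harmonic (u : ℕ) :
    ∑ j ∈ Finset.range u, (harmonic j : ℝ) = u * harmonic u - u := by
  induction u with
  | zero => simp
  | succ u ih =>
    rw [Finset.sum_range_succ, ih, harmonic_succ_real]
    push_cast
    field_simp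
    ring

theorem sum_range_harmonic_sub_one (u : ℕ) :
    ∑ j ∈ Finset.range (u + 1), max ((harmonic j : ℝ) - 1) 0 =
      (u + 1) * harmonic (u + 1) - 2 * (u + 1) + 1 := by
  have h1 : ∀ j ∈ Finset.range u, max ((harmonic (j + 1) : ℝ) - 1) 0 = harmonic (j + 1) - 1 :=
    fun j _ => max_eq_left (by linarith [one_le_harmonic (Nat.succ_pos j)])
  have h2 := sum_range_harmonic (u + 1)
  rw [Finset.sum_range_succ'] at h2 ⊢
  rw [Finset.sum_congr rfl h1, Finset.sum_sub_distrib]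
  simp only [harmonic_zero, Finset.sum_const, Finset.card_range, nsmul_eq_mul] at h2 ⊢
  push_cast at h2 ⊢
  -- The truncation acts only at j = 0, where H_0 - 1 = -1; this produces the summand + 1 in the
  -- result.
  rw [max_eq_right (by norm_num)]
  linarith

theorem detLen_le (k : ℕ) : (detLen k : ℝ) ≤ harmonic k := by
  have h0 : (0 : ℚ) ≤ harmonic k := by exact_mod_cast harmonic_nonneg k
  have := Nat.floor_le h0
  exact_mod_cast this

theorem harmonic_lt_detLen (k : ℕ) : (harmonic k : ℝ) < detLen k + 1 := by
  have := Nat.lt_floor_add_one (harmonic k)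
  exact_mod_cast this

theorem one_le_detLen {k : ℕ} (hk : 0 < k) : 1 ≤ detLen k := by
  refine Nat.le_floor ?_
  exact_mod_cast one_le_harmonic hk

/-- States that the savings of a chain of length `detLen k` suffice for the random part. If `u` and
`detLen k` are at least 2, then 1/u ≤ 1/(u+1) + 1/(u+2), so the left side is at most H_{u+2} ≤ H_k <
`detLen k` + 1. -/
theorem harmonic_add_inv_le {k u : ℕ} (hu : 0 < u) (huk : detLen k + u ≤ k) :
    (harmonic u : ℝ) + (u : ℝ)⁻¹ ≤ detLen k + 1 := by
  have hk : 0 < k := by omega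
  have h1 := one_le_detLen hk
  have hlt := harmonic_lt_detLen k
  rcases Nat.lt_or_ge u 2 with h2 | h2
  · have : u = 1 := by omega
    subst this
    have : (1 : ℝ) ≤ detLen k := by exact_mod_cast h1
    simp
    linarith
  · have hu' : (2 : ℝ) ≤ u := by exact_mod_cast h2
    rcases Nat.lt_or_ge (detLen k) 2 with h3 | h3
    · have h4 : detLen k = 1 := by omega
      rw [h4] at hlt ⊢
      -- H_4 = 25/12 exceeds 2, so `detLen k = 1` leaves only `k = 3`, `u = 2`, with equality.
      have h5 : k < 4 := by
        by_contra hcon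
        have h6 := harmonic_mono (not_lt.1 hcon)
        have h7 : (harmonic 4 : ℝ) = 25 / 12 := by
          norm_num [harmonic, Finset.sum_range_succ]
        rw [h7] at h6
        norm_num at hlt
        linarith
      have : u = 2 := by omega
      subst this
      norm_num [harmonic, Finset.sum_range_succ]
    · have h4 := harmonic_mono (show u + 1 + 1 ≤ k by omega)
      rw [harmonic_succ_real, harmonic_succ_real] at h4
      have h5 : (u : ℝ)⁻¹ ≤ ((u : ℝ) + 1)⁻¹ + (((u + 1 : ℕ) : ℝ) + 1)⁻¹ := by
        push_cast
        rw [inv_add_inv (by positivity) (by positivity), inv_eq_one_div,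
          div_le_div_iff₀ (by positivity) (by positivity)]
        nlinarith
      linarith

/-- Distinct next arrivals have distinct ranks. -/
theorem sum_rank_le {α : Type*} {n : ℕ} (U : Finset α) (T : α → ℕ) (g : ℕ → ℝ)
    (hg : ∀ j, 0 ≤ g j)
    (hT : ∀ e ∈ U, ∀ e' ∈ U, T e < n → T e = T e' → e = e') :
    ∑ e ∈ U, (if T e < n then g (U.filter fun x => T e < T x).card else 0) ≤
      ∑ j ∈ Finset.range U.card, g j := by
  have hlt : ∀ e ∈ U, ∀ e' ∈ U, T e < T e' →
      (U.filter fun x => T e' < T x).card < (U.filter fun x => T e < T x).card := by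
    intro e _ e' he' hee
    refine Finset.card_lt_card (Finset.ssubset_iff_of_subset ?_ |>.2 ⟨e', ?_, ?_⟩)
    · intro x hx
      rw [Finset.mem_filter] at hx ⊢
      exact ⟨hx.1, hee.trans hx.2⟩
    · exact Finset.mem_filter.2 ⟨he', hee⟩
    · simp
  rw [← Finset.sum_filter]
  have hinj : Set.InjOn (fun e => (U.filter fun x => T e < T x).card)
      (U.filter fun e => T e < n : Finset α) := by
    intro e he e' he' hee
    simp only [Finset.coe_filter, Set.mem_ofPred_eq] at he he' hee
    rcases lt_trichotomy (T e) (T e') with hl | hl | hl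
    · exact absurd hee (hlt e he.1 e' he'.1 hl).ne'
    · exact hT e he.1 e' he'.1 he.2 hl
    · exact absurd hee (hlt e' he'.1 e he.1 hl).ne
  rw [← Finset.sum_image (f := g) hinj]
  refine Finset.sum_le_sum_of_subset_of_nonneg ?_ fun j _ _ => hg j
  intro j hj
  obtain ⟨e, he, rfl⟩ := Finset.mem_image.1 hj
  rw [Finset.mem_range]
  exact Finset.card_lt_card (Finset.filter_ssubset.2 ⟨e, (Finset.mem_filter.1 he).1, lt_irrefl _⟩)

/-! ### The bound without predictions -/

/-- The potential of a chain in the analysis that ignores the predictions. -/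
def robustPotential (k n c τ r : ℕ) : ℝ :=
  if τ < n then ((detLen k - c : ℕ) : ℝ) + harmonic r else 0

/-- A chain reserves one unit for each predicted eviction still allowed and H_r for the random ones.
At its start 1 + (`detLen k` - 1) + H_r ≤ 2 H_k. -/
theorem isPotential_robust {α : Type*} {k : ℕ} (hk : 0 < k) {n : ℕ} (z : Fin n → α)
    (h : Fin n → ℝ) (tie : Fin n → ℕ) :
    IsPotential k z h tie (2 * harmonic k) (fun _ _ => 0) (fun _ => 0) (robustPotential k n) where
  lam_nonneg := by linarith [harmonic_nonneg k]
  phi_nonneg c τ r := by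
    have := harmonic_nonneg r
    unfold robustPotential
    split_ifs <;> positivity
  phi_mono c τ r r' hr := by
    have := harmonic_mono hr
    unfold robustPotential
    split_ifs <;> linarith
  G_nonneg _ _ := le_rfl
  G_insert _ _ _ := le_rfl
  G_evict _ _ _ _ _ _ _ := by simp
  clean τ r _ hr := by
    have h1 := one_le_harmonic hk
    have h2 := harmonic_mono hr.le
    have h3 := detLen_le k
    unfold robustPotential
    rw [Nat.cast_sub (one_le_detLen hk)]
    push_cast
    split_ifs <;> linarith
  det c τ₀ τ r u _ hc hτ hτn _ hr := by
    have h2 := harmonic_mono hr.le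
    have h3 := harmonic_nonneg u
    have h4 : ((detLen k - c : ℕ) : ℝ) = ((detLen k - (c + 1) : ℕ) : ℝ) + 1 := by
      rw [← Nat.cast_add_one]
      congr 1
      omega
    unfold robustPotential
    rw [if_pos (lt_of_lt_of_le hτ hτn), h4]
    have : (0 : ℝ) ≤ ((detLen k - (c + 1) : ℕ) : ℝ) := by positivity
    split_ifs <;> linarith
  rand U T c τ₀ _ hU _ hc hτ _ _ hinj _ := by
    have h1 := sum_rank_le (n := n) U T (fun j => (harmonic j : ℝ)) harmonic_nonneg hinj
    rw [sum_range_harmonic] at h1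
    unfold robustPotential
    rw [if_pos hτ, Nat.sub_eq_zero_of_le hc, Nat.sub_eq_zero_of_le (by omega),
      Finset.sum_add_distrib]
    simp only [Nat.cast_zero, zero_add, Finset.sum_const, nsmul_eq_mul, mul_one, mul_zero,
      add_zero]
    linarith

/-! ### The bound by the error of the predictions -/

/-- The elements requested at time `t` or later. -/
def requestedFrom {α : Type*} {n : ℕ} (z : Fin n → α) (t : ℕ) : Finset α :=
  (Finset.univ.filter fun i : Fin n => t ≤ i).image z

/-- The arrivals outside of `K` from time `t` on that are not the next arrival of an element that
was evicted before time `t`, where `C` is the cache at that time. -/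
def openArrivals {α : Type*} {n : ℕ} (z : Fin n → α) (K : Finset (Fin n)) (t : ℕ)
    (C : Finset α) : Finset (Fin n) :=
  Finset.univ.filter fun τ =>
    τ ∉ K ∧ t ≤ τ ∧ ((∃ i : Fin n, t ≤ i ∧ i < τ ∧ z i = z τ) ∨ z τ ∈ C)

/-- The budget for the evictions of elements that never arrive again, and of elements whose next
arrival is not in `K`. -/
def errorBudget {α : Type*} (k : ℕ) {n : ℕ} (z : Fin n → α) (K : Finset (Fin n)) (t : ℕ)
    (C : Finset α) : ℝ :=
  (((C ∪ requestedFrom z t).card - k : ℕ) : ℝ) + 2 * (openArrivals z K t C).card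

/-- What the eviction of an element that next arrives at time `τ` takes out of the budget. -/
def errorWeight {n : ℕ} (K : Finset (Fin n)) (τ : ℕ) : ℝ :=
  if τ < n then if τ ∈ K.image Fin.val then 0 else 2 else 1

/-- Some arrival in `K` up to time `τ` is predicted to come no earlier than the one at
time `τ`. -/
def Dominated {α : Type*} {n : ℕ} (z : Fin n → α) (h : Fin n → ℝ) (tie : Fin n → ℕ)
    (K : Finset (Fin n)) (τ : ℕ) : Prop :=
  ∃ a ∈ K.image Fin.val, a ≤ τ ∧ arrivalKeyAt z h tie τ ≤ arrivalKeyAt z h tie a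

/-- The potential of a chain in the analysis by the error of the predictions. -/
def errorPotential {α : Type*} (k : ℕ) {n : ℕ} (z : Fin n → α) (h : Fin n → ℝ) (tie : Fin n → ℕ)
    (K : Finset (Fin n)) (c τ r : ℕ) : ℝ :=
  if τ < n then
    if c ≤ detLen k then ((c - 1 : ℕ) : ℝ) + if Dominated z h tie K τ then 0 else 2
    else harmonic r
  else 0

section error

variable {α : Type*} {k n : ℕ} {z : Fin n → α} {h : Fin n → ℝ} {tie : Fin n → ℕ}
  {K : Finset (Fin n)}

theorem mem_requestedFrom {t : ℕ} {x : α} :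
    x ∈ requestedFrom z t ↔ ∃ i : Fin n, t ≤ i ∧ z i = x := by
  simp [requestedFrom]

theorem mem_openArrivals {t : ℕ} {C : Finset α} {τ : Fin n} :
    τ ∈ openArrivals z K t C ↔
      τ ∉ K ∧ t ≤ τ ∧ ((∃ i : Fin n, t ≤ i ∧ i < τ ∧ z i = z τ) ∨ z τ ∈ C) := by
  simp [openArrivals]

theorem union_requestedFrom_subset {t : ℕ} (ht : t < n) {C C' : Finset α}
    (hC : C' ⊆ insert (z ⟨t, ht⟩) C) : C' ∪ requestedFrom z (t + 1) ⊆ C ∪ requestedFrom z t := by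
  intro x hx
  rw [Finset.mem_union, mem_requestedFrom] at hx ⊢
  rcases hx with hx | ⟨i, hi, rfl⟩
  · rcases Finset.mem_insert.1 (hC hx) with rfl | hx
    · exact Or.inr ⟨⟨t, ht⟩, le_rfl, rfl⟩
    · exact Or.inl hx
  · exact Or.inr ⟨i, by omega, rfl⟩

theorem openArrivals_subset {t : ℕ} (ht : t < n) {C C' : Finset α}
    (hC : C' ⊆ insert (z ⟨t, ht⟩) C) : openArrivals z K (t + 1) C' ⊆ openArrivals z K t C := by
  intro τ hτ
  rw [mem_openArrivals] at hτ ⊢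
  obtain ⟨h1, h2, h3⟩ := hτ
  refine ⟨h1, by omega, ?_⟩
  rcases h3 with ⟨i, h4, h5⟩ | h4
  · exact Or.inl ⟨i, by omega, h5⟩
  · rcases Finset.mem_insert.1 (hC h4) with h4 | h4
    · exact Or.inl ⟨⟨t, ht⟩, le_rfl, Fin.lt_def.2 h2, h4.symm⟩
    · exact Or.inr h4

/-- If `e` returns outside `K`, this arrival ceases to be open: `e` has left the cache and is not
requested before it. If `e` never returns, it disappears from the union of the cache and the future
requests. -/
theorem errorBudget_evict {t : ℕ} (ht : t < n) {C : Finset α} {e : α} (hz : z ⟨t, ht⟩ ∉ C)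
    (hC : C.card = k) (he : e ∈ C) :
    errorBudget k z K (t + 1) ((insert (z ⟨t, ht⟩) C).erase e) +
      errorWeight K (nxt z (t + 1) e) ≤ errorBudget k z K t C := by
  have hez : e ≠ z ⟨t, ht⟩ := ne_of_mem_of_not_mem he hz
  have hsub : (insert (z ⟨t, ht⟩) C).erase e ⊆ insert (z ⟨t, ht⟩) C := Finset.erase_subset _ _
  have hs1 := union_requestedFrom_subset ht hsub
  have hs2 := openArrivals_subset (K := K) ht hsub
  have hc1 := Finset.card_le_card hs1
  have hc2 := Finset.card_le_card hs2
  set A := C ∪ requestedFrom z t with hA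
  set A' := (insert (z ⟨t, ht⟩) C).erase e ∪ requestedFrom z (t + 1) with hA'
  set B := openArrivals z K t C with hB
  set B' := openArrivals z K (t + 1) ((insert (z ⟨t, ht⟩) C).erase e) with hB'
  -- The missing element is an additional member besides the full cache, so the truncated difference
  -- really drops when `e` disappears.
  have hk : k + 1 ≤ A.card := by
    rw [← hC, ← Finset.card_insert_of_notMem hz]
    refine Finset.card_le_card (Finset.insert_subset ?_ Finset.subset_union_left)
    exact Finset.mem_union_right _ (mem_requestedFrom.2 ⟨⟨t, ht⟩, le_rfl, rfl⟩)
  suffices hmain : ((A'.card - k : ℕ) : ℝ) + errorWeight K (nxt z (t + 1) e) + 2 * (B'.card : ℝ) ≤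
      ((A.card - k : ℕ) : ℝ) + 2 * (B.card : ℝ) by
    unfold errorBudget
    linarith
  have hr1 : ((A'.card - k : ℕ) : ℝ) ≤ ((A.card - k : ℕ) : ℝ) := by
    exact_mod_cast Nat.sub_le_sub_right hc1 k
  have hr2 : (B'.card : ℝ) ≤ (B.card : ℝ) := by exact_mod_cast hc2
  unfold errorWeight
  split_ifs with h1 h2
  · linarith
  · set τ : Fin n := ⟨nxt z (t + 1) e, h1⟩ with hτ
    have hzτ : z τ = e := apply_nxt (Nat.succ_le_of_lt ht) h1
    have hle : t + 1 ≤ τ.1 := le_nxt (Nat.succ_le_of_lt ht)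
    have hmem : τ ∈ B := by
      refine mem_openArrivals.2 ⟨fun hK => h2 (Finset.mem_image.2 ⟨τ, hK, rfl⟩), by omega, ?_⟩
      rw [hzτ]
      exact Or.inr he
    have hnot : τ ∉ B' := by
      rw [hB', mem_openArrivals, hzτ]
      rintro ⟨_, _, ⟨i, hi1, hi2, hi3⟩ | hi⟩
      · have := nxt_le_of_eq hi1 hi3
        exact absurd (Fin.lt_def.1 hi2) (not_lt.2 this)
      · simp at hi
    have : B'.card < B.card :=
      Finset.card_lt_card (Finset.ssubset_iff_of_subset hs2 |>.2 ⟨τ, hmem, hnot⟩)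
    have : (B'.card : ℝ) + 1 ≤ (B.card : ℝ) := by exact_mod_cast this
    linarith
  · have hmem : e ∈ A := Finset.mem_union_left _ he
    have hnot : e ∉ A' := by
      rw [hA', Finset.mem_union, mem_requestedFrom]
      rintro (hi | ⟨i, hi1, hi2⟩)
      · simp at hi
      · have := nxt_le_of_eq hi1 hi2
        omega
    have : A'.card < A.card :=
      Finset.card_lt_card (Finset.ssubset_iff_of_subset hs1 |>.2 ⟨e, hmem, hnot⟩)
    have : ((A'.card - k : ℕ) : ℝ) + 1 ≤ ((A.card - k : ℕ) : ℝ) := by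
      have : A'.card - k + 1 ≤ A.card - k := by omega
      exact_mod_cast this
    linarith

theorem dominated_of_mem {τ : ℕ} (hτ : τ ∈ K.image Fin.val) : Dominated z h tie K τ :=
  ⟨τ, hτ, le_rfl, le_rfl⟩

/-- Along a chain, at most one representative arrives at a time in `K`. -/
theorem two_add_le (hK : ∀ s ∈ K, ∀ t ∈ K, s < t → arrivalKey z h tie s < arrivalKey z h tie t)
    {τ₀ τ : ℕ} (hτ : τ₀ < τ) (hτn : τ < n)
    (hle : arrivalKeyAt z h tie τ ≤ arrivalKeyAt z h tie τ₀) :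
    (2 : ℝ) + (if Dominated z h tie K τ then 0 else 2) ≤
      (if Dominated z h tie K τ₀ then 0 else 2) + errorWeight K τ := by
  unfold errorWeight
  rw [if_pos hτn]
  by_cases h0 : Dominated z h tie K τ₀
  · obtain ⟨a, ha, h1, h2⟩ := h0
    -- Domination passes along the chain: times increase and predicted keys do not.
    have hd : Dominated z h tie K τ := ⟨a, ha, h1.trans hτ.le, hle.trans h2⟩
    -- Otherwise `a < τ` would both lie in `K` with their predictions in the wrong order.
    have hn : τ ∉ K.image Fin.val := by
      intro hτK
      obtain ⟨a', ha', rfl⟩ := Finset.mem_image.1 ha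
      obtain ⟨τ', hτ', rfl⟩ := Finset.mem_image.1 hτK
      have h3 := hK a' ha' τ' hτ' (Fin.lt_def.2 (by omega))
      have h4 := hle.trans h2
      simp only [arrivalKeyAt, a'.2, τ'.2, dif_pos, Fin.eta] at h4
      exact absurd h3 (not_lt.2 h4)
    rw [if_pos hd, if_pos ⟨a, ha, h1, h2⟩, if_neg hn]
    norm_num
  · rw [if_neg h0]
    by_cases hτK : τ ∈ K.image Fin.val
    · rw [if_pos (dominated_of_mem hτK), if_pos hτK]
    · rw [if_neg hτK]
      split_ifs <;> norm_num

/-- The potential of a short chain is its saving `c - 1`, plus 2 as long as a return in `K` may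
still come. In long chains the harmonic potential of the robust analysis takes over. -/
theorem isPotential_error (hk : 0 < k)
    (hK : ∀ s ∈ K, ∀ t ∈ K, s < t → arrivalKey z h tie s < arrivalKey z h tie t) :
    IsPotential k z h tie 1 (errorBudget k z K) (errorWeight K)
      (errorPotential k z h tie K) where
  lam_nonneg := zero_le_one
  phi_nonneg c τ r := by
    have := harmonic_nonneg r
    unfold errorPotential
    split_ifs <;> positivity
  phi_mono c τ r r' hr := by
    have := harmonic_mono hr
    unfold errorPotential
    split_ifs <;> first | exact this | exact le_rfl
  G_nonneg t C := by
    unfold errorBudget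
    positivity
  G_insert t ht C := by
    have h1 := Finset.card_le_card (union_requestedFrom_subset ht (le_refl (insert (z ⟨t, ht⟩) C)))
    have h2 := Finset.card_le_card
      (openArrivals_subset (K := K) ht (le_refl (insert (z ⟨t, ht⟩) C)))
    unfold errorBudget
    gcongr
  G_evict t ht C e hz hC he := errorBudget_evict ht hz hC he
  clean τ r _ _ := by
    unfold errorPotential errorWeight
    rw [if_pos (one_le_detLen hk)]
    by_cases hτ : τ < n
    · simp only [if_pos hτ]
      by_cases hτK : τ ∈ K.image Fin.val
      · rw [if_pos (dominated_of_mem hτK), if_pos hτK]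
        norm_num
      · rw [if_neg hτK]
        split_ifs <;> norm_num
    · simp only [if_neg hτ]
      norm_num
  det c τ₀ τ r u hc1 hc hτ hτn hle _ := by
    have hcast : ((c + 1 - 1 : ℕ) : ℝ) = ((c - 1 : ℕ) : ℝ) + 1 := by
      rw [← Nat.cast_add_one]
      congr 1
      omega
    unfold errorPotential
    rw [if_pos (lt_of_lt_of_le hτ hτn), if_pos hc, if_pos (show c ≤ detLen k by omega), hcast]
    by_cases hlt : τ < n
    · have := two_add_le hK hτ hlt (hle hlt)
      rw [if_pos hlt]
      linarith
    · rw [if_neg hlt, errorWeight, if_neg hlt]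
      have : (0 : ℝ) ≤ ((c - 1 : ℕ) : ℝ) := by positivity
      split_ifs <;> linarith
  rand U T c τ₀ hc1 hU hcU hc hτ hT hTn hinj hord := by
    have hu0 : 0 < U.card := Finset.card_pos.2 hU
    have hphi : ∀ e, errorPotential k z h tie K (c + 1) (T e)
        (U.filter fun x => T e < T x).card =
        if T e < n then (harmonic (U.filter fun x => T e < T x).card : ℝ) else 0 := fun e => by
      unfold errorPotential
      rw [if_neg (show ¬ c + 1 ≤ detLen k by omega)]
    simp only [hphi]
    unfold errorPotential
    rw [if_pos hτ]
    rcases Nat.eq_or_lt_of_le hc with hceq | hclt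
    · rw [if_pos hceq.ge]
      set β : ℝ := if Dominated z h tie K τ₀ then 0 else 2 with hβ
      have hβ0 : 0 ≤ β := by
        rw [hβ]
        split_ifs <;> norm_num
      -- The change from predictions to random evictions: of the two units given by `two_add_le` one
      -- pays the eviction and the other lowers H_r to H_r - 1. An element that never returns pays
      -- with its weight 1.
      have hterm : ∀ e ∈ U, 1 + (if T e < n then
          (harmonic (U.filter fun x => T e < T x).card : ℝ) else 0) ≤
          ((if T e < n then
            max ((harmonic (U.filter fun x => T e < T x).card : ℝ) - 1) 0 else 0) + β) +
          errorWeight K (T e) := fun e he => by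
        by_cases hlt : T e < n
        · have h1 := two_add_le hK (hT e he) hlt (hord hceq.symm e he hlt)
          rw [← hβ] at h1
          have h2 : (0 : ℝ) ≤ if Dominated z h tie K (T e) then 0 else 2 := by
            split_ifs <;> norm_num
          rw [if_pos hlt, if_pos hlt]
          linarith [le_max_left ((harmonic (U.filter fun x => T e < T x).card : ℝ) - 1) 0]
        · rw [if_neg hlt, if_neg hlt, errorWeight, if_neg hlt]
          linarith
      refine (Finset.sum_le_sum hterm).trans ?_
      rw [Finset.sum_add_distrib, Finset.sum_add_distrib, Finset.sum_const, nsmul_eq_mul]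
      have h1 := sum_rank_le (n := n) U T (fun j => max ((harmonic j : ℝ) - 1) 0)
        (fun j => le_max_right _ _) hinj
      obtain ⟨m, hm⟩ := Nat.exists_eq_add_of_lt hu0
      rw [zero_add] at hm
      have h2 := harmonic_add_inv_le (k := k) hu0 (by omega)
      have h3 := sum_range_harmonic_sub_one m
      have h4 : ((c - 1 : ℕ) : ℝ) = (detLen k : ℝ) - 1 := by
        rw [Nat.cast_sub hc1, hceq]
        norm_num
      rw [hm] at h1 h2 ⊢
      rw [h4]
      push_cast at h2 ⊢
      -- With u = m + 1 this reads u H_u + 1 ≤ u (`detLen k` + 1), that is, the sum u H_u - 2u + 1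
      -- is at most u (`detLen k` - 1).
      have h5 : ((m : ℝ) + 1) * ((harmonic (m + 1) : ℝ) + ((m : ℝ) + 1)⁻¹) ≤
          ((m : ℝ) + 1) * (detLen k + 1) := mul_le_mul_of_nonneg_left h2 (by positivity)
      rw [mul_add, mul_inv_cancel₀ (by positivity)] at h5
      linarith
    · rw [if_neg (by omega), Finset.sum_add_distrib]
      have h1 := sum_rank_le (n := n) U T (fun j => (harmonic j : ℝ)) harmonic_nonneg hinj
      rw [sum_range_harmonic] at h1
      have h2 : 0 ≤ ∑ e ∈ U, errorWeight K (T e) := Finset.sum_nonneg fun e _ => by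
        unfold errorWeight
        split_ifs <;> norm_num
      simp only [Finset.sum_const, nsmul_eq_mul, mul_one]
      linarith

end error

/-! ### Bounds on the expected number of evictions -/

section evictions

variable {α : Type*} {k n : ℕ} (z : Fin n → α) (h : Fin n → ℝ) (tie : Fin n → ℕ)

theorem core_init : Core k z h tie 0 (State.init α) := by
  constructor <;> simp [State.init]

theorem predOk_init : PredOk z h tie 0 (State.init α).pred := by
  rintro x ⟨i, hi, _⟩
  omega

theorem expect_evictions_le_robust (hk : 0 < k) :
    expect (predictiveMarker k z h tie) State.evictions ≤
      ENNReal.ofReal (2 * harmonic k * cleanFrom k z 0 ∅ ∅) := by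
  rw [predictiveMarker_eq_run]
  refine (expect_run_le hk (isPotential_robust hk z h tie) 0 (Nat.zero_le n) _
    (core_init z h tie) (predOk_init z h tie)).trans (le_of_eq ?_)
  simp [bound, State.init]

theorem expect_evictions_le_error (hk : 0 < k) (htie : Function.Injective tie) :
    expect (predictiveMarker k z h tie) State.evictions ≤
      ENNReal.ofReal (cleanFrom k z 0 ∅ ∅ + ((requestedFrom z 0).card - k : ℕ) +
        2 * editError z h tie) := by
  obtain ⟨K, hK, hcard⟩ := exists_monotone_arrivals z h tie htie
  rw [predictiveMarker_eq_run]
  refine (expect_run_le hk (isPotential_error hk hK) 0 (Nat.zero_le n) _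
    (core_init z h tie) (predOk_init z h tie)).trans (ENNReal.ofReal_le_ofReal ?_)
  have hsub : (openArrivals z K 0 ∅).card ≤ editError z h tie := by
    refine (Finset.card_le_card fun τ hτ => ?_).trans hcard
    rw [mem_openArrivals] at hτ
    obtain ⟨h1, _, ⟨i, _, h2, h3⟩ | h2⟩ := hτ
    · exact Finset.mem_filter.2 ⟨Finset.mem_univ _, h1, i, mem_earlier.2 ⟨h2, h3⟩⟩
    · simp at h2
  have hsub' : ((openArrivals z K 0 ∅).card : ℝ) ≤ editError z h tie := by exact_mod_cast hsub
  simp only [bound, State.init, errorBudget, Finset.sdiff_self, Finset.sum_empty,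
    Finset.empty_union, Nat.cast_zero]
  linarith

end evictions

/-! ### Misses and evictions -/

section misses

variable {α : Type*} {k n : ℕ} {z : Fin n → α} {h : Fin n → ℝ} {tie : Fin n → ℕ}

/-- Misses that are not evictions have filled the cache. -/
structure Balanced {α : Type*} (k : ℕ) {n : ℕ} (z : Fin n → α) (s : State α) : Prop where
  misses_eq : s.misses = s.evictions + s.cache.card
  card_le : s.cache.card ≤ k
  subset : s.cache ⊆ requestedFrom z 0

theorem mem_of_mem_support_evictee {s : State α} {x e : α} (he : e ∈ (s.evictee k x).support) :
    e ∈ s.cache ∨ e = x := by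
  unfold State.evictee at he
  split_ifs at he with hU hc
  · rw [PMF.mem_support_pure_iff] at he
    rw [he]
    exact Or.inl (Finset.mem_sdiff.1 (argmaxPred_mem _ _ _)).1
  · rw [PMF.mem_support_uniformOfFinset_iff] at he
    exact Or.inl (Finset.mem_sdiff.1 he).1
  · rw [PMF.mem_support_pure_iff] at he
    exact Or.inr he

theorem Balanced.step {s s' : State α} (hs : Balanced k z s) (t : Fin n) (q : Key)
    (hs' : s' ∈ (step k (z t) q s).support) : Balanced k z s' := by
  have hz : z t ∈ requestedFrom z 0 := mem_requestedFrom.2 ⟨t, Nat.zero_le _, rfl⟩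
  unfold Caching.step at hs'
  dsimp only at hs'
  split_ifs at hs' with h1 h2
  · rw [PMF.mem_support_pure_iff] at hs'
    subst hs'
    exact ⟨hs.misses_eq, hs.card_le, hs.subset⟩
  · rw [PMF.mem_support_pure_iff] at hs'
    subst hs'
    have := hs.misses_eq
    refine ⟨?_, ?_, Finset.insert_subset hz hs.subset⟩
    · dsimp only
      rw [Finset.card_insert_of_notMem h1]
      omega
    · dsimp only
      rw [Finset.card_insert_of_notMem h1]
      omega
  · rw [PMF.support_map] at hs'
    obtain ⟨e, he, rfl⟩ := hs'
    have he := mem_of_mem_support_evictee he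
    set s₁ : State α := { s with pred := Function.update s.pred (z t) q } with hs₁
    have hm : (s₁.newPhase k).misses = s.misses := by
      unfold State.newPhase
      split_ifs <;> rfl
    have hev : (s₁.newPhase k).evictions = s.evictions := by
      unfold State.newPhase
      split_ifs <;> rfl
    have hca : (s₁.newPhase k).cache = s.cache := newPhase_cache
    rw [hca] at he
    have hcard : ((insert (z t) s.cache).erase e).card = s.cache.card := by
      rw [Finset.card_erase_of_mem, Finset.card_insert_of_notMem h1, Nat.add_sub_cancel]
      rw [Finset.mem_insert]
      exact he.symm
    have := hs.misses_eq
    constructor <;> simp only [State.replace, hm, hev, hca, hcard]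
    · omega
    · exact hs.card_le
    · exact (Finset.erase_subset _ _).trans (Finset.insert_subset hz hs.subset)

theorem Balanced.run {t : ℕ} (ht : t ≤ n) : ∀ s : State α, Balanced k z s →
    ∀ s' ∈ (run k z h tie t s).support, Balanced k z s' := by
  induction ht using Nat.decreasingInduction with
  | self =>
    intro s hs s' hs'
    rw [run_of_le k z h tie le_rfl, PMF.mem_support_pure_iff] at hs'
    rwa [hs']
  | of_succ t ht ih =>
    intro s hs s' hs'
    rw [run_of_lt k z h tie ht, PMF.mem_support_bind_iff] at hs'
    obtain ⟨s₁, h1, h2⟩ := hs'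
    exact ih s₁ (hs.step _ _ h1) s' h2

/-- On every run, misses minus evictions is the size of the final cache, which consists of requested
elements. -/
theorem expect_misses_le (k : ℕ) (z : Fin n → α) (h : Fin n → ℝ) (tie : Fin n → ℕ) :
    expect (predictiveMarker k z h tie) State.misses ≤
      expect (predictiveMarker k z h tie) State.evictions +
        (min k (requestedFrom z 0).card : ℕ) := by
  refine expect_mono _ _ _ _ fun s hs => ?_
  rw [predictiveMarker_eq_run] at hs
  have hB := Balanced.run (k := k) (z := z) (h := h) (tie := tie) (Nat.zero_le n) (State.init α)
    ⟨rfl, Nat.zero_le _, Finset.empty_subset _⟩ s hs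
  have h1 := hB.misses_eq
  have h2 := hB.card_le
  have h3 := Finset.card_le_card hB.subset
  omega

end misses

/-! ### Lower bounds on the offline optimum -/

section opt

variable {α : Type*} {k n : ℕ} {z : Fin n → α} {C : ℕ → Finset α}

/-- All elements that are in the cache of the schedule `C` at some time in `[a, b]`. -/
def cachedIn {α : Type*} (C : ℕ → Finset α) (a b : ℕ) : Finset α := (Finset.Icc a b).biUnion C

theorem mem_cachedIn {a b : ℕ} {x : α} : x ∈ cachedIn C a b ↔ ∃ i, a ≤ i ∧ i ≤ b ∧ x ∈ C i := by
  simp [cachedIn, and_assoc]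

theorem cachedIn_mono {a a' b b' : ℕ} (ha : a' ≤ a) (hb : b ≤ b') :
    cachedIn C a b ⊆ cachedIn C a' b' := by
  intro x hx
  obtain ⟨i, h1, h2, h3⟩ := mem_cachedIn.1 hx
  exact mem_cachedIn.2 ⟨i, by omega, by omega, h3⟩

theorem cachedIn_self (a : ℕ) : cachedIn C a a = C a := by simp [cachedIn]

theorem cachedIn_succ {a b : ℕ} (hab : a ≤ b) :
    cachedIn C a (b + 1) = cachedIn C a b ∪ C (b + 1) := by
  ext x
  rw [Finset.mem_union, mem_cachedIn, mem_cachedIn]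
  constructor
  · rintro ⟨i, h1, h2, h3⟩
    rcases Nat.lt_or_eq_of_le h2 with h | h
    · exact Or.inl ⟨i, h1, by omega, h3⟩
    · exact Or.inr (h ▸ h3)
  · rintro (⟨i, h1, h2, h3⟩ | h3)
    · exact ⟨i, h1, by omega, h3⟩
    · exact ⟨b + 1, by omega, le_rfl, h3⟩

/-- The number of misses of a schedule before time `b`. -/
def missesUntil {α : Type*} {n : ℕ} (z : Fin n → α) (C : ℕ → Finset α) (b : ℕ) : ℕ :=
  ∑ i ∈ Finset.range b, if hi : i < n then (if z ⟨i, hi⟩ ∉ C i then 1 else 0) else 0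

/-- The number of evictions of a schedule before time `b`. -/
def evictionsUntil {α : Type*} (C : ℕ → Finset α) (b : ℕ) : ℕ :=
  ∑ i ∈ Finset.range b, (C i \ C (i + 1)).card

theorem missesUntil_eq : missesUntil z C n = scheduleMisses z C := by
  unfold missesUntil scheduleMisses
  rw [Finset.card_filter, ← Fin.sum_univ_eq_sum_range (fun i => if hi : i < n then
    (if z ⟨i, hi⟩ ∉ C i then 1 else 0) else 0) n]
  refine Finset.sum_congr rfl fun i _ => ?_
  rw [dif_pos i.2]

theorem evictionsUntil_eq : evictionsUntil C n = scheduleEvictions n C := by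
  unfold evictionsUntil scheduleEvictions
  rw [← Fin.sum_univ_eq_sum_range (fun i => (C i \ C (i + 1)).card) n]

/-- Whatever is cached during the interval was there at its start or was fetched by a miss. -/
theorem card_cachedIn_le_misses (hC : IsSchedule k z C) {a b : ℕ} (hab : a ≤ b) (hb : b ≤ n) :
    (cachedIn C a b).card + missesUntil z C a ≤ (C a).card + missesUntil z C b := by
  induction b, hab using Nat.le_induction with
  | base => rw [cachedIn_self]
  | succ b hab ih =>
    have ih := ih (by omega)
    have hsucc : missesUntil z C (b + 1) =
        missesUntil z C b + if z ⟨b, hb⟩ ∉ C b then 1 else 0 := by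
      rw [missesUntil, Finset.sum_range_succ, ← missesUntil, dif_pos (show b < n from hb)]
    rw [cachedIn_succ hab, hsucc]
    have hsub : C b ⊆ cachedIn C a b := fun x hx => mem_cachedIn.2 ⟨b, hab, le_rfl, hx⟩
    by_cases hz : z ⟨b, hb⟩ ∈ C b
    · have : cachedIn C a b ∪ C (b + 1) = cachedIn C a b := by
        refine Finset.union_eq_left.2 fun x hx => hsub ?_
        rcases hC.subset ⟨b, hb⟩ x hx with rfl | h
        · exact hz
        · exact h
      rw [this, if_neg (by simpa using hz)]
      omega
    · have : cachedIn C a b ∪ C (b + 1) ⊆ insert (z ⟨b, hb⟩) (cachedIn C a b) := by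
        refine Finset.union_subset (Finset.subset_insert _ _) fun x hx => ?_
        rcases hC.subset ⟨b, hb⟩ x hx with rfl | h
        · exact Finset.mem_insert_self _ _
        · exact Finset.mem_insert_of_mem (hsub h)
      have := (Finset.card_le_card this).trans (Finset.card_insert_le _ _)
      rw [if_pos hz]
      omega

/-- Dual to the count of misses: whatever is cached during the interval is there at its end or was
evicted. -/
theorem card_cachedIn_le_evictions {a b : ℕ} (hab : a ≤ b) :
    (cachedIn C a b).card + evictionsUntil C a ≤ (C b).card + evictionsUntil C b := by
  have key : (cachedIn C a b \ C b).card + evictionsUntil C a ≤ evictionsUntil C b := by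
    induction b, hab using Nat.le_induction with
    | base => simp [cachedIn_self]
    | succ b hab ih =>
      have hsub : cachedIn C a (b + 1) \ C (b + 1) ⊆
          (cachedIn C a b \ C b) ∪ (C b \ C (b + 1)) := by
        rw [cachedIn_succ hab]
        intro x hx
        simp only [Finset.mem_sdiff, Finset.mem_union] at hx ⊢
        tauto
      have h1 := (Finset.card_le_card hsub).trans (Finset.card_union_le _ _)
      rw [evictionsUntil, evictionsUntil, Finset.sum_range_succ, ← evictionsUntil,
        ← evictionsUntil]
      omega
  have h1 := Finset.card_sdiff_add_card (cachedIn C a b) (C b)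
  have h2 : (cachedIn C a b).card ≤ (cachedIn C a b ∪ C b).card :=
    Finset.card_le_card Finset.subset_union_left
  omega

theorem requestedFrom_subset_cachedIn (hC : IsSchedule k z C) :
    requestedFrom z 0 ⊆ cachedIn C 0 n := by
  intro x hx
  obtain ⟨i, _, rfl⟩ := mem_requestedFrom.1 hx
  exact mem_cachedIn.2 ⟨i + 1, Nat.zero_le _, i.2, hC.mem i⟩

/-- The clean requests from time `t` on, and those before it in the current phase, are paid for
by the cost of the schedule since the start of the previous phase `p`, and of the
current phase `q`. -/
theorem cleanFrom_add_le (hk : 0 < k) (hC : IsSchedule k z C) {cost : ℕ → ℕ}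
    (hmono : Monotone cost)
    (hcost : ∀ a b, a ≤ b → b ≤ n → (cachedIn C a b).card + cost a ≤ k + cost b)
    {t : ℕ} (ht : t ≤ n) : ∀ (M S : Finset α) (p q : ℕ), p ≤ q → q ≤ t → S.card = k →
      M ⊆ cachedIn C q t → S ∪ M ⊆ cachedIn C p t →
      cleanFrom k z t M S + (M \ S).card + cost p + cost q ≤ 2 * cost n := by
  -- The set `S ∪ M` has `k + (M \ S).card` elements, all cached at some time in `[p, t]`.
  have hpay : ∀ t ≤ n, ∀ (M S : Finset α) (p : ℕ), p ≤ t → S.card = k →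
      S ∪ M ⊆ cachedIn C p t → (M \ S).card + cost p ≤ cost t := by
    intro t ht M S p hp hS hSM
    have h1 := hcost p t hp ht
    have h2 := Finset.card_le_card hSM
    have h3 := Finset.card_sdiff_add_card M S
    rw [Finset.union_comm] at h3
    omega
  induction ht using Nat.decreasingInduction with
  | self =>
    intro M S p q hpq hq hS hM hSM
    have h1 := hpay n le_rfl M S p (hpq.trans hq) hS hSM
    have h2 := hmono hq
    rw [cleanFrom_of_le le_rfl]
    omega
  | of_succ t ht ih =>
    intro M S p q hpq hq hS hM hSM
    have hz : z ⟨t, ht⟩ ∈ C (t + 1) := hC.mem ⟨t, ht⟩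
    have hzin : ∀ a ≤ t, z ⟨t, ht⟩ ∈ cachedIn C a (t + 1) := fun a ha =>
      mem_cachedIn.2 ⟨t + 1, by omega, le_rfl, hz⟩
    have hM' := hM.trans (cachedIn_mono le_rfl (Nat.le_succ t))
    have hSM' := hSM.trans (cachedIn_mono le_rfl (Nat.le_succ t))
    have hSne : S.Nonempty := Finset.card_pos.1 (by omega)
    rw [cleanFrom_eq ht]
    split_ifs with h1 h2 h3
    · exact ih M S p q hpq (by omega) hS hM' hSM'
    -- The finished phase is charged to `[p, t]`, and the window moves on to start at `q`, with the
    -- new phase starting at `t`. Its first request is clean and forms the set difference of size 1.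
    · have h4 := hpay t ht.le M S p (hpq.trans hq) hS hSM
      have h5 := ih {z ⟨t, ht⟩} M q t hq (Nat.le_succ t) h2
        (Finset.singleton_subset_iff.2 (hzin t le_rfl))
        (Finset.union_subset hM' (Finset.singleton_subset_iff.2 (hzin q hq)))
      have h6 : ({z ⟨t, ht⟩} \ M).card = 1 := by
        rw [Finset.sdiff_eq_self_of_disjoint (Finset.disjoint_singleton_left.2 h1),
          Finset.card_singleton]
      omega
    all_goals
      have h5 := ih (insert (z ⟨t, ht⟩) M) S p q hpq (by omega) hS
        (Finset.insert_subset (hzin q hq) hM')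
        (Finset.union_subset (Finset.subset_union_left.trans hSM')
          (Finset.insert_subset (hzin p (hpq.trans hq)) (Finset.subset_union_right.trans hSM')))
    · rw [Finset.insert_sdiff_of_notMem _ h3.2, Finset.card_insert_of_notMem (by simp [h1])] at h5
      omega
    · have h6 : z ⟨t, ht⟩ ∈ S := by
        by_contra hcon
        exact h3 ⟨hSne, hcon⟩
      rw [Finset.insert_sdiff_of_mem _ h6] at h5
      omega

/-- The clean requests, together with the requests of the first phase up to `d`, are paid for by
twice the cost of the schedule. -/
theorem cleanFrom_first_phase_le (hk : 0 < k) (hC : IsSchedule k z C) {cost : ℕ → ℕ}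
    (hmono : Monotone cost)
    (hcost : ∀ a b, a ≤ b → b ≤ n → (cachedIn C a b).card + cost a ≤ k + cost b) {d : ℕ}
    (hd : ∀ b ≤ n, (cachedIn C 0 b).card ≤ d + cost b)
    {t : ℕ} (ht : t ≤ n) : ∀ M : Finset α, M ⊆ cachedIn C 0 t →
      cleanFrom k z t M ∅ + (min k (M ∪ requestedFrom z t).card - d) ≤ 2 * cost n := by
  induction ht using Nat.decreasingInduction with
  | self =>
    intro M hM
    have h1 := (Finset.card_le_card hM).trans (hd n le_rfl)
    have h2 : requestedFrom z n = ∅ := by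
      refine Finset.eq_empty_of_forall_notMem fun x hx => ?_
      obtain ⟨i, hi, _⟩ := mem_requestedFrom.1 hx
      omega
    rw [cleanFrom_of_le le_rfl, h2, Finset.union_empty]
    omega
  | of_succ t ht ih =>
    intro M hM
    have hz : z ⟨t, ht⟩ ∈ C (t + 1) := hC.mem ⟨t, ht⟩
    have hzin : ∀ a ≤ t, z ⟨t, ht⟩ ∈ cachedIn C a (t + 1) := fun a ha =>
      mem_cachedIn.2 ⟨t + 1, by omega, le_rfl, hz⟩
    have hM' := hM.trans (cachedIn_mono le_rfl (Nat.le_succ t))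
    have hun : M ∪ requestedFrom z t = insert (z ⟨t, ht⟩) M ∪ requestedFrom z (t + 1) := by
      ext x
      simp only [Finset.mem_union, Finset.mem_insert, mem_requestedFrom]
      constructor
      · rintro (hx | ⟨i, hi, rfl⟩)
        · exact Or.inl (Or.inr hx)
        · rcases Nat.lt_or_eq_of_le hi with hlt | heq
          · exact Or.inr ⟨i, hlt, rfl⟩
          · exact Or.inl (Or.inl (congrArg z (Fin.ext heq.symm)))
      · rintro ((rfl | hx) | ⟨i, hi, rfl⟩)
        · exact Or.inr ⟨⟨t, ht⟩, le_rfl, rfl⟩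
        · exact Or.inl hx
        · exact Or.inr ⟨i, by omega, rfl⟩
    rw [cleanFrom_eq ht]
    split_ifs with h1 h2 h3
    · rw [hun, Finset.insert_eq_of_mem h1]
      exact ih M hM'
    -- At the end of the first phase its `k` elements have already cost `k - d`, which the term
    -- `cost t` in `cleanFrom_add_le` leaves room for.
    · have h4 := (Finset.card_le_card hM).trans (hd t ht.le)
      have h5 := cleanFrom_add_le hk hC hmono hcost (Nat.succ_le_of_lt ht) {z ⟨t, ht⟩} M 0 t
        (Nat.zero_le t) (Nat.le_succ t) h2
        (Finset.singleton_subset_iff.2 (hzin t le_rfl))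
        (Finset.union_subset hM' (Finset.singleton_subset_iff.2 (hzin 0 (Nat.zero_le t))))
      have h6 : ({z ⟨t, ht⟩} \ M).card = 1 := by
        rw [Finset.sdiff_eq_self_of_disjoint (Finset.disjoint_singleton_left.2 h1),
          Finset.card_singleton]
      have h7 : min k (M ∪ requestedFrom z t).card ≤ k := min_le_left _ _
      simp only [Nat.succ_eq_add_one] at h5
      omega
    · simp at h3
    · rw [hun, zero_add]
      exact ih _ (Finset.insert_subset (hzin 0 (Nat.zero_le t)) hM')

/-- Here `d = 0`: from an empty cache every element of the first phase costs a miss. -/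
theorem clean_le_misses (hk : 0 < k) (hC : IsSchedule k z C) :
    cleanFrom k z 0 ∅ ∅ + min k (requestedFrom z 0).card ≤ 2 * scheduleMisses z C := by
  have hmono : Monotone (missesUntil z C) := fun a b hab =>
    Finset.sum_le_sum_of_subset (Finset.range_subset_range.2 hab)
  have h1 := cleanFrom_first_phase_le (d := 0) hk hC hmono (fun a b hab hb =>
    (card_cachedIn_le_misses hC hab hb).trans (Nat.add_le_add_right (hC.card_le a) _))
    (fun b hb => by
      have := card_cachedIn_le_misses hC (Nat.zero_le b) hb
      rw [hC.zero, Finset.card_empty] at this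
      omega) (Nat.zero_le n) ∅ (Finset.empty_subset _)
  rwa [missesUntil_eq, Finset.empty_union, Nat.sub_zero] at h1

theorem requested_le_misses (hC : IsSchedule k z C) :
    (requestedFrom z 0).card ≤ scheduleMisses z C := by
  have h1 := Finset.card_le_card (requestedFrom_subset_cachedIn hC)
  have h2 := card_cachedIn_le_misses hC (Nat.zero_le n) le_rfl
  rw [hC.zero, Finset.card_empty, missesUntil_eq] at h2
  omega

/-- Here `d = k`: filling the cache is free, so the first phase contributes nothing. -/
theorem clean_le_evictions (hk : 0 < k) (hC : IsSchedule k z C) :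
    cleanFrom k z 0 ∅ ∅ ≤ 2 * scheduleEvictions n C := by
  have hmono : Monotone (evictionsUntil C) := fun a b hab =>
    Finset.sum_le_sum_of_subset (Finset.range_subset_range.2 hab)
  have hcost : ∀ a b, a ≤ b → b ≤ n →
      (cachedIn C a b).card + evictionsUntil C a ≤ k + evictionsUntil C b := fun a b hab _ =>
    (card_cachedIn_le_evictions hab).trans (Nat.add_le_add_right (hC.card_le b) _)
  have h1 := cleanFrom_first_phase_le (d := k) hk hC hmono hcost
    (fun b hb => (Nat.le_add_right _ _).trans (hcost 0 b (Nat.zero_le b) hb))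
    (Nat.zero_le n) ∅ (Finset.empty_subset _)
  rw [evictionsUntil_eq] at h1
  omega

theorem requested_le_evictions (hC : IsSchedule k z C) :
    (requestedFrom z 0).card - k ≤ scheduleEvictions n C := by
  have h1 := Finset.card_le_card (requestedFrom_subset_cachedIn hC)
  have h2 := card_cachedIn_le_evictions (C := C) (Nat.zero_le n)
  have h3 := hC.card_le n
  rw [evictionsUntil_eq (n := n)] at h2
  omega

theorem exists_isSchedule (hk : 0 < k) (z : Fin n → α) : ∃ C, IsSchedule k z C := by
  -- The schedule that keeps only the element requested last.
  refine ⟨fun t => Finset.univ.filter (fun i : Fin n => i.1 + 1 = t) |>.image z, ?_, ?_, ?_, ?_⟩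
  · simp
  · intro t
    refine Finset.card_image_le.trans (le_trans ?_ hk)
    refine Finset.card_le_one.2 fun i hi j hj => ?_
    simp only [Finset.mem_filter, Finset.mem_univ, true_and] at hi hj
    exact Fin.ext (by omega)
  · intro t
    exact Finset.mem_image.2 ⟨t, by simp, rfl⟩
  · intro t x hx
    obtain ⟨i, hi, rfl⟩ := Finset.mem_image.1 hx
    simp only [Finset.mem_filter, Finset.mem_univ, true_and] at hi
    exact Or.inl (congrArg z (Fin.ext (by omega)))

theorem exists_optMisses (hk : 0 < k) (z : Fin n → α) :
    ∃ C, IsSchedule k z C ∧ optMisses k z = scheduleMisses z C := by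
  obtain ⟨C, hC⟩ := exists_isSchedule hk z
  exact Nat.sInf_mem (s := {m | ∃ C : ℕ → Finset α, IsSchedule k z C ∧ m = scheduleMisses z C})
    ⟨_, C, hC, rfl⟩

theorem exists_optEvictions (hk : 0 < k) (z : Fin n → α) :
    ∃ C, IsSchedule k z C ∧ optEvictions k z = scheduleEvictions n C := by
  obtain ⟨C, hC⟩ := exists_isSchedule hk z
  exact Nat.sInf_mem
    (s := {m | ∃ C : ℕ → Finset α, IsSchedule k z C ∧ m = scheduleEvictions n C})
    ⟨_, C, hC, rfl⟩

end opt

/-! ### Combination of the two bounds -/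

theorem le_ofReal_min_mul {E : ℝ≥0∞} {x y H η o : ℝ} (hx : E ≤ ENNReal.ofReal x)
    (hy : E ≤ ENNReal.ofReal y) (ho : 0 ≤ o) (hxo : x ≤ 4 * H * o) (hyo : y ≤ 3 * o + 2 * η) :
    E ≤ ENNReal.ofReal (min (3 + 2 * (η / o)) (4 * H) * o) := by
  -- For `o = 0` the quotient has no meaning, but the bound without predictions already gives 0.
  rcases ho.eq_or_lt with rfl | ho
  · rw [mul_zero] at hxo ⊢
    exact hx.trans (ENNReal.ofReal_le_ofReal hxo)
  · rw [min_mul_of_nonneg _ _ ho.le]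
    have h1 : (3 + 2 * (η / o)) * o = 3 * o + 2 * η := by
      field_simp
    rw [h1]
    rcases min_choice (3 * o + 2 * η) (4 * H * o) with h | h <;> rw [h]
    · exact hy.trans (ENNReal.ofReal_le_ofReal hyo)
    · exact hx.trans (ENNReal.ofReal_le_ofReal hxo)

end Caching

end

theorem mainTheorem5 {α : Type*} (k : ℕ) (hk : 0 < k) {n : ℕ} (z : Fin n → α)
    (h : Fin n → ℝ) (tie : Fin n → ℕ) (htie : Function.Injective tie) :
    Caching.expect (Caching.predictiveMarker k z h tie) Caching.State.misses ≤
        ENNReal.ofReal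
          (min (3 + 2 * ((Caching.editError z h tie : ℝ) / (Caching.optMisses k z : ℝ)))
            (4 * (harmonic k : ℝ)) * (Caching.optMisses k z : ℝ)) ∧
      Caching.expect (Caching.predictiveMarker k z h tie) Caching.State.evictions ≤
        ENNReal.ofReal
          (min (3 + 2 * ((Caching.editError z h tie : ℝ) / (Caching.optEvictions k z : ℝ)))
            (4 * (harmonic k : ℝ)) * (Caching.optEvictions k z : ℝ)) := by
  have hrob := Caching.expect_evictions_le_robust z h tie hk
  have herr := Caching.expect_evictions_le_error z h tie hk htie
  have hH := Caching.one_le_harmonic hk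
  constructor
  · obtain ⟨C, hC, hopt⟩ := Caching.exists_optMisses hk z
    rw [hopt]
    have hm := Caching.expect_misses_le k z h tie
    have h1 := Caching.clean_le_misses hk hC
    have h2 := Caching.requested_le_misses hC
    set D := (Caching.requestedFrom z 0).card
    set L := Caching.cleanFrom k z 0 ∅ ∅
    set o := Caching.scheduleMisses z C
    have h1' : (L : ℝ) + (min k D : ℕ) ≤ 2 * o := by exact_mod_cast h1
    have h3 : ((D - k : ℕ) : ℝ) + (min k D : ℕ) ≤ o := by
      have : D - k + min k D ≤ o := by omega
      exact_mod_cast this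
    have h0 : (0 : ℝ) ≤ (min k D : ℕ) := by positivity
    have hadd : ∀ x : ℝ, 0 ≤ x → ENNReal.ofReal x + ((min k D : ℕ) : ENNReal) =
        ENNReal.ofReal (x + (min k D : ℕ)) := fun x hx => by
      rw [ENNReal.ofReal_add hx h0, ENNReal.ofReal_natCast]
    refine Caching.le_ofReal_min_mul
      ((hm.trans (add_le_add hrob le_rfl)).trans (hadd _ (by positivity)).le)
      ((hm.trans (add_le_add herr le_rfl)).trans (hadd _ (by positivity)).le)
      (by positivity) ?_ ?_
    -- As 1 ≤ H_k, the misses that fill the cache are absorbed: 2 H_k L + min(k, D) ≤ 2 H_k (L +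
    -- min(k, D)).
    · nlinarith
    · linarith
  · obtain ⟨C, hC, hopt⟩ := Caching.exists_optEvictions hk z
    rw [hopt]
    have h1 := Caching.clean_le_evictions hk hC
    have h2 := Caching.requested_le_evictions hC
    have h1' : (Caching.cleanFrom k z 0 ∅ ∅ : ℝ) ≤ 2 * Caching.scheduleEvictions n C := by
      exact_mod_cast h1
    have h2' : (((Caching.requestedFrom z 0).card - k : ℕ) : ℝ) ≤
        Caching.scheduleEvictions n C := by
      exact_mod_cast h2
    refine Caching.le_ofReal_min_mul hrob herr (by positivity) ?_ ?_
    · nlinarith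
    · linarith
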